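/- For integers $a\le b$ let $[a,b]=\{a,a+1,\dots,b\}$, and let $[a,b]=\emptyset$ if $a>b$. Let $\mathcal D_n$ be the group of even signed permutations of degree $n$, that is, the bijections $\sigma$ of $\{\pm1,\dots,\pm n\}$ with $\sigma(-i)=-\sigma(i)$ for all $i$ and with an even number of negative entries among $\sigma(1),\dots,\sigma(n)$. It is the Weyl group of type $D_n$ with generators $s_0=(1,-2)(-1,2)$ and $s_i=(i,i+1)(-i,-(i+1))$, $1\le i\le n-1$, acting linearly on $\mathbb Z^n$ by $e_i\mapsto e_{\sigma(i)}$, where $e_{-i}=-e_i$. The roots are $\pm(e_i\pm e_j)$, $1\le i<j\le n$, and the simple roots are $e_1+e_2$ and $e_{i+1}-e_i$, $1\le i\le n-1$. The positive roots are the roots that are nonnegative combinations of simple roots, the negative roots are their negatives, and the height of a root is the sum of its coefficients with respect to the simple roots. For $w\in\mathcal D_n$ let $\ell(w)$ be the number of positive roots that $w$ sends to negative roots, and let $L(w)$ be the number of positive roots of odd height that $w$ sends to negative roots. For $I\subseteq[0,n-1]$ put $$\mathcal D_n^I=\{w\in\mathcal D_n \mid \ell(ws_i)>\ell(w)\text{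 for all }i\in I\},\qquad \mathcal D_n^I(x)=\sum_{w\in\mathcal D_n^I}(-1)^{\ell(w)}x^{L(w)}\in\mathbb Z[x].$$ For nonnegative integers $m_1,\dots,m_k$ with sum $m$ let $$\begin{bmatrix}m\\ m_1,\dots,m_k\end{bmatrix}_q=\frac{[m]_q!}{[m_1]_q!\cdots[m_k]_q!},\qquad [r]_q!=\prod_{i=1}^r\frac{1-q^i}{1-q}.$$ **Proposition.** Let $s\ge 1$ and let $a_0<a_1<\dots<a_{s-1}<a_s=n$ be integers with $a_0\equiv a_1\equiv\dots\equiv a_s\pmod 2$ and $2\le a_0\le n-2$. Let $$I=[0,a_0-1]\cup[a_0+1,a_1-1]\cup\dots\cup[a_{s-1}+1,n-1]\quad\text{and}\quad J=[0,a_0-1]\cup[a_0+1,n-1].$$ Then $$\mathcal D_n^I(x)=\begin{bmatrix}\frac{n-a_0}{2}\\ \frac{a_1-a_0}{2},\frac{a_2-a_1}{2},\dots,\frac{n-a_{s-1}}{2}\end{bmatrix}_{x^2}\,\mathcal D_n^J(x).$$ -/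

import Mathlib

open Polynomial

namespace TypeD

/-! ### Signed permutations -/

/-- The set `[n]± = {-n, …, -1} ∪ {1, …, n}`. -/
abbrev SignedIndex (n : ℕ) : Type := {k : ℤ // k ≠ 0 ∧ |k| ≤ (n : ℤ)}

noncomputable instance (n : ℕ) : Fintype (SignedIndex n) :=
  Fintype.ofInjective
    (fun k : SignedIndex n =>
      (⟨k.1, Finset.mem_Icc.2 (abs_le.1 k.2.2)⟩ : ↥(Finset.Icc (-(n : ℤ)) n)))
    (fun _ _ h => Subtype.ext (congrArg (fun z => z.1) h))

/-- The involution `k ↦ -k` of `[n]±`. -/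
instance (n : ℕ) : Neg (SignedIndex n) :=
  ⟨fun k => ⟨-k.1, neg_ne_zero.2 k.2.1, (abs_neg k.1).trans_le k.2.2⟩⟩

/-- The positive element `i + 1` of `[n]±`, for `i = 0, …, n - 1`. -/
def pos {n : ℕ} (i : Fin n) : SignedIndex n :=
  ⟨(i : ℤ) + 1, by omega, by have := i.2; rw [abs_of_nonneg] <;> omega⟩

/-- Membership in the even hyperoctahedral group: a bijection `σ` of `[n]±` onto itself with
`σ(-k) = -σ(k)` and an even number of negative entries among `σ(1), …, σ(n)`. -/
def IsEvenSigned {n : ℕ} (σ : Equiv.Perm (SignedIndex n)) : Prop :=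
  (∀ k, σ (-k) = -σ k) ∧ Even (Finset.univ.filter fun i : Fin n => (σ (pos i)).1 < 0).card

/-- The signed permutation `(j, k)(-j, -k)`. -/
def signedSwap {n : ℕ} (j k : SignedIndex n) : Equiv.Perm (SignedIndex n) :=
  Equiv.swap j k * Equiv.swap (-j) (-k)

/-- The Coxeter generators of the even hyperoctahedral group, indexed by `0, …, n - 1`:
`s_0 = (1, -2)(-1, 2)` and `s_i = (i, i+1)(-i, -(i+1))` for `1 ≤ i ≤ n - 1`.
(For `n = 1` there is no `s_0`; a dummy value is used.) -/
def gen {n : ℕ} (i : Fin n) : Equiv.Perm (SignedIndex n) :=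
  if (i : ℕ) = 0 then
    if h : 2 ≤ n then signedSwap (pos ⟨0, by omega⟩) (-pos ⟨1, by omega⟩) else 1
  else signedSwap (pos ⟨(i : ℕ) - 1, by omega⟩) (pos i)

/-! ### The root system of type `D_n` -/

/-- `stdVec n k` is the standard basis vector `e_k` of `ℤⁿ` for `1 ≤ k ≤ n` (the coordinates are
numbered `1, …, n`, the `m`-th one being at `m - 1 : Fin n`), with `e_{-k} = -e_k`. -/
def stdVec (n : ℕ) (k : ℤ) : Fin n → ℤ :=
  fun m => if |k| = (m : ℤ) + 1 then k.sign else 0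

/-- The roots `±(e_i - e_j)`, `±(e_i + e_j)`, `1 ≤ i < j ≤ n`. -/
def roots (n : ℕ) : Set (Fin n → ℤ) :=
  {v | ∃ i j : ℤ, 1 ≤ i ∧ i < j ∧ j ≤ n ∧
    (v = stdVec n i - stdVec n j ∨ v = -(stdVec n i - stdVec n j) ∨
      v = stdVec n i + stdVec n j ∨ v = -(stdVec n i + stdVec n j))}

/-- The simple roots: `α_0 = e_1 + e_2` and `α_i = e_{i+1} - e_i` for `1 ≤ i ≤ n - 1`. -/
def simpleRoot (n : ℕ) (i : Fin n) : Fin n → ℤ :=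
  if (i : ℕ) = 0 then stdVec n 1 + stdVec n 2 else stdVec n ((i : ℤ) + 1) - stdVec n i

/-- Positive roots: the roots that are nonnegative combinations of simple roots. -/
def posRoots (n : ℕ) : Set (Fin n → ℤ) :=
  {v ∈ roots n | ∃ c : Fin n → ℕ, v = ∑ i, c i • simpleRoot n i}

/-- Negative roots: the negatives of the positive roots. -/
def negRoots (n : ℕ) : Set (Fin n → ℤ) := {v | -v ∈ posRoots n}

/-- `v` has height `h`: `v` is an integral combination of the simple roots with coefficient
sum `h` (the simple roots are linearly independent for `2 ≤ n`). -/
def HasHeight {n : ℕ} (v : Fin n → ℤ) (h : ℤ) : Prop :=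
  ∃ c : Fin n → ℤ, v = ∑ i, c i • simpleRoot n i ∧ ∑ i, c i = h

/-- The linear action of a signed permutation on `ℤⁿ`, given by `e_i ↦ e_{σ(i)}`. -/
def act {n : ℕ} (σ : Equiv.Perm (SignedIndex n)) (v : Fin n → ℤ) : Fin n → ℤ :=
  ∑ i, v i • stdVec n (σ (pos i)).1

/-- There are finitely many roots, so that the cardinalities below are genuine. -/
theorem roots_finite (n : ℕ) : (roots n).Finite := by
  let f : ℤ × ℤ → Set (Fin n → ℤ) := fun p =>
    {stdVec n p.1 - stdVec n p.2, -(stdVec n p.1 - stdVec n p.2),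
      stdVec n p.1 + stdVec n p.2, -(stdVec n p.1 + stdVec n p.2)}
  have hf : (⋃ p ∈ Set.Icc (1 : ℤ) n ×ˢ Set.Icc (1 : ℤ) n, f p).Finite := by
    refine Set.Finite.biUnion ((Set.finite_Icc _ _).prod (Set.finite_Icc _ _)) fun p _ => ?_
    exact Set.toFinite _
  refine hf.subset ?_
  rintro v ⟨i, j, hi, hij, hj, hv⟩
  simp only [Set.mem_iUnion]
  exact ⟨(i, j), ⟨⟨hi, by simp only; omega⟩, ⟨by simp only; omega, hj⟩⟩, hv⟩

/-- The Coxeter length: the number of positive roots sent to negative roots. -/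
noncomputable def len {n : ℕ} (σ : Equiv.Perm (SignedIndex n)) : ℕ :=
  {α ∈ posRoots n | act σ α ∈ negRoots n}.ncard

/-- The odd length: the number of positive roots of odd height sent to negative roots. -/
noncomputable def oddLen {n : ℕ} (σ : Equiv.Perm (SignedIndex n)) : ℕ :=
  {α ∈ posRoots n | (∃ h, HasHeight α h ∧ Odd h) ∧ act σ α ∈ negRoots n}.ncard

/-! ### Parabolic quotients and their generating functions -/

open Classical in
/-- The parabolic quotient: the `w` in the even hyperoctahedral group with
`ℓ(w s_i) > ℓ(w)` for all `i ∈ I`, where `I ⊆ {0, …, n - 1}`. -/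
noncomputable def quotient (n : ℕ) (I : Finset ℕ) : Finset (Equiv.Perm (SignedIndex n)) :=
  Finset.univ.filter fun w =>
    IsEvenSigned w ∧ ∀ i : Fin n, (i : ℕ) ∈ I → len w < len (w * gen i)

/-- The sign-twisted generating function of the odd length,
`∑ (-1)^{ℓ(w)} x^{L(w)}` over the parabolic quotient. -/
noncomputable def genFun (n : ℕ) (I : Finset ℕ) : ℤ[X] :=
  ∑ w ∈ quotient n I, (-1) ^ len w * X ^ oddLen w

/-! ### `q`-multinomial coefficients -/

/-- `[n]_q = (1 - q^n) / (1 - q)`. -/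
def qInt {K : Type*} [Field K] (q : K) (n : ℕ) : K := (1 - q ^ n) / (1 - q)

/-- `[n]_q! = [1]_q [2]_q ⋯ [n]_q`. -/
def qFactorial {K : Type*} [Field K] (q : K) (n : ℕ) : K := ∏ i ∈ Finset.Icc 1 n, qInt q i

/-- `[n]_q! / ([n_1]_q! ⋯ [n_k]_q!)`, for `n_1 + ⋯ + n_k = n`. -/
def qMultinomial {K : Type*} [Field K] (q : K) (n : ℕ) {k : ℕ} (p : Fin k → ℕ) : K :=
  qFactorial q n / ∏ i, qFactorial q (p i)

/-! ### Compressed sets -/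

/-- The set `[0, a_0 - 1] ∪ [a_0 + 1, a_1 - 1] ∪ ⋯ ∪ [a_{s-1} + 1, a_s - 1]`. -/
def blockSet {s : ℕ} (a : Fin (s + 1) → ℕ) : Finset ℕ :=
  Finset.range (a 0) ∪
    Finset.univ.biUnion fun i : Fin s => Finset.Ico (a i.castSucc + 1) (a i.succ)

/-- `a_0 < ⋯ < a_s` lie in `[0, n]` and are all congruent modulo 2, that is, they present
`blockSet a` as a compressed subset of `[0, n - 1]`. -/
def IsCompressed (n : ℕ) {s : ℕ} (a : Fin (s + 1) → ℕ) : Prop :=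
  StrictMono a ∧ (∀ i, a i ≤ n) ∧ ∀ i j, a i ≡ a j [MOD 2]

end TypeD

namespace TypeD

/-! Both sides are compared with one refinement: `pairSet n (a 0)` keeps the block of positions up
to `a 0` and cuts everything beyond it into blocks of length two. Every `a i` has the parity of `a
0`, so `I` and `J` both arise from it by merging adjacent blocks. Merging pairs into blocks of
lengths `a_{i+1} - a_i` costs the product of the factorials `[(a_{i+1} - a_i)/2]!` at `q = x²`
(`genFun_pairSet_eq_prod_mul_blockSet`), and merging all of them into one block costs `[(n -
a_0)/2]!`. Equating the two expressions for the generating function of the refinement and dividing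
gives the multinomial coefficient.

The core is `genFun_eq_mul_genFun_insert`: merging a pair with a preceding increasing block of
length `2B` costs `1 + x² + ⋯ + x^{2B}`. An element of the quotient is classified by the numbers `i
≤ j` of block entries below the first and the second entry of the pair. Exchanging the first entry
of the pair with the value next to it flips the sign and keeps the odd length, so the types `(i, j)`
and `(i + 1, j)` with `i` even and `i < j` cancel (`shuffleSum_eq_neg`). Only the types `(j, j)`
with `j` even survive. Moving the pair past two block entries preserves the sign and changes the odd
length by two (`shuffleSum_diag`), and type `(2B, 2B)` is the quotient for the merged block
(`shuffleSum_full`).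

All this rests on reading length and odd length off the entries `w(1), …, w(n)`: both count pairs of
positions, and `weight_comp_swap` records how such a count reacts to exchanging two entries. -/

/-! ### Heights of roots through a linear functional. -/

/-- The height functional on `ℤⁿ`, pairing with `(0, 1, …, n - 1)`. -/
def ht {n : ℕ} : (Fin n → ℤ) →ₗ[ℤ] ℤ where
  toFun v := ∑ m : Fin n, (m : ℤ) * v m
  map_add' u v := by simp [mul_add, Finset.sum_add_distrib]
  map_smul' c v := by
    simp only [Pi.smul_apply, smul_eq_mul, RingHom.id_apply, Finset.mul_sum]
    exact Finset.sum_congr rfl fun _ _ => by ring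

theorem stdVec_neg (n : ℕ) (k : ℤ) : stdVec n (-k) = -stdVec n k := by
  ext m
  simp only [stdVec, abs_neg, Int.sign_neg, Pi.neg_apply]
  split_ifs <;> simp

theorem ht_stdVec {n : ℕ} {k : ℤ} (h0 : k ≠ 0) (hk : |k| ≤ n) :
    ht (stdVec n k) = k - k.sign := by
  have h1 : 1 ≤ |k| := Int.one_le_abs h0
  obtain ⟨r, hr⟩ : ∃ r : ℕ, |k| = (r : ℤ) + 1 := ⟨(|k| - 1).toNat, by omega⟩
  have hrn : r < n := by omega
  have : ht (stdVec n k) = ∑ m : Fin n, if m = ⟨r, hrn⟩ then (r : ℤ) * k.sign else 0 := by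
    change ∑ m : Fin n, (m : ℤ) * stdVec n k m = _
    refine Finset.sum_congr rfl fun m _ => ?_
    simp only [stdVec, hr, Fin.ext_iff]
    by_cases h : (m : ℕ) = r
    · simp [h]
    · rw [if_neg (by omega), if_neg h, mul_zero]
  rw [this, Finset.sum_ite_eq' Finset.univ, if_pos (Finset.mem_univ _)]
  have h2 := Int.sign_mul_abs k
  rw [hr] at h2
  linarith

/-- Since `ht` is linear and equals one on every simple root, it computes the coefficient sum of any
expansion; linear independence of the simple roots is never needed. -/
theorem ht_simpleRoot {n : ℕ} (hn : 2 ≤ n) (i : Fin n) : ht (simpleRoot n i) = 1 := by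
  have hi := i.2
  unfold simpleRoot
  split_ifs with h
  · rw [map_add, ht_stdVec (by norm_num) (by rw [abs_of_nonneg] <;> omega),
      ht_stdVec (by norm_num) (by rw [abs_of_nonneg] <;> omega)]
    rw [Int.sign_eq_one_of_pos (by norm_num), Int.sign_eq_one_of_pos (by norm_num)]
    norm_num
  · rw [map_sub, ht_stdVec (by omega) (by rw [abs_of_nonneg] <;> omega),
      ht_stdVec (by omega) (by rw [abs_of_nonneg] <;> omega),
      Int.sign_eq_one_of_pos (by omega), Int.sign_eq_one_of_pos (by omega)]
    ring

theorem ht_sum_simpleRoot {n : ℕ} (hn : 2 ≤ n) (c : Fin n → ℤ) :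
    ht (∑ i, c i • simpleRoot n i) = ∑ i, c i := by
  rw [map_sum]
  exact Finset.sum_congr rfl fun i _ => by rw [map_smul, ht_simpleRoot hn, smul_eq_mul, mul_one]

theorem HasHeight.eq_ht {n : ℕ} (hn : 2 ≤ n) {v : Fin n → ℤ} {h : ℤ} (hv : HasHeight v h) :
    h = ht v := by
  obtain ⟨c, rfl, rfl⟩ := hv
  rw [ht_sum_simpleRoot hn]

/-! ### Explicit positive roots and the sign criterion. -/

/-- The root `e_{j+1} + e_{i+1}` (for `b = true`) or `e_{j+1} - e_{i+1}` (for `b = false`). -/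
def rootOf (n i j : ℕ) (b : Bool) : Fin n → ℤ :=
  stdVec n (j + 1) + bif b then stdVec n (i + 1) else -stdVec n (i + 1)

theorem rootOf_apply {n i j : ℕ} (hij : i < j) (b : Bool) (m : Fin n) :
    rootOf n i j b m =
      if (m : ℕ) = j then 1 else if (m : ℕ) = i then (bif b then 1 else -1) else 0 := by
  have h1 : |(j : ℤ) + 1| = j + 1 := abs_of_nonneg (by omega)
  have h2 : |(i : ℤ) + 1| = i + 1 := abs_of_nonneg (by omega)
  have h3 : ((j : ℤ) + 1).sign = 1 := Int.sign_eq_one_of_pos (by omega)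
  have h4 : ((i : ℤ) + 1).sign = 1 := Int.sign_eq_one_of_pos (by omega)
  have h5 : ((j : ℤ) + 1 = (m : ℕ) + 1) ↔ (m : ℕ) = j := by omega
  have h6 : ((i : ℤ) + 1 = (m : ℕ) + 1) ↔ (m : ℕ) = i := by omega
  cases b <;> simp only [rootOf, cond_true, cond_false, Pi.add_apply, Pi.neg_apply, stdVec,
    h1, h2, h3, h4, h5, h6] <;> split_ifs <;> omega

theorem rootOf_injective {n i j i' j' : ℕ} {b b' : Bool} (hij : i < j) (hj : j < n)
    (hij' : i' < j') (hj' : j' < n) (h : rootOf n i j b = rootOf n i' j' b') :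
    i = i' ∧ j = j' ∧ b = b' := by
  have key : ∀ m, m < n →
      (if m = j then (1 : ℤ) else if m = i then (bif b then 1 else -1) else 0) =
        if m = j' then 1 else if m = i' then (bif b' then 1 else -1) else 0 := by
    intro m hm
    have := congrFun h ⟨m, hm⟩
    rwa [rootOf_apply hij, rootOf_apply hij'] at this
  have k1 := key i (by omega)
  have k2 := key j (by omega)
  have k3 := key i' (by omega)
  have k4 := key j' (by omega)
  cases b <;> cases b' <;> simp only [cond_true, cond_false] at k1 k2 k3 k4 <;>
    split_ifs at k1 k2 k3 k4 <;>
      first | exact ⟨by omega, by omega, rfl⟩ | (exfalso; omega)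

theorem ht_rootOf {n i j : ℕ} (hij : i < j) (hj : j < n) (b : Bool) :
    ht (rootOf n i j b) = (j : ℤ) + bif b then (i : ℤ) else -i := by
  have h3 : ((j : ℤ) + 1).sign = 1 := Int.sign_eq_one_of_pos (by omega)
  have h4 : ((i : ℤ) + 1).sign = 1 := Int.sign_eq_one_of_pos (by omega)
  have e1 := ht_stdVec (n := n) (k := (j : ℤ) + 1) (by omega) (by rw [abs_of_nonneg] <;> omega)
  have e2 := ht_stdVec (n := n) (k := (i : ℤ) + 1) (by omega) (by rw [abs_of_nonneg] <;> omega)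
  cases b <;> simp only [rootOf, cond_true, cond_false, map_add, map_neg, e1, e2, h3, h4] <;> ring

/-- The monoid of nonnegative combinations of simple roots. -/
def simpleCone (n : ℕ) : AddSubmonoid (Fin n → ℤ) where
  carrier := {v | ∃ c : Fin n → ℕ, v = ∑ i, c i • simpleRoot n i}
  zero_mem' := ⟨0, by simp⟩
  add_mem' := by
    rintro _ _ ⟨c, rfl⟩ ⟨d, rfl⟩
    exact ⟨c + d, by simp [add_smul, Finset.sum_add_distrib]⟩

theorem simpleRoot_mem_simpleCone {n : ℕ} (i : Fin n) : simpleRoot n i ∈ simpleCone n :=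
  ⟨Pi.single i 1, by
    rw [Finset.sum_eq_single i] <;> simp +contextual⟩

theorem stdVec_sub_mem_simpleCone {n i : ℕ} (d : ℕ) (h : i + d < n) :
    stdVec n ((i + d : ℕ) + 1) - stdVec n (i + 1) ∈ simpleCone n := by
  induction d with
  | zero => simp
  | succ d ih =>
    have h1 := simpleRoot_mem_simpleCone (n := n) ⟨i + (d + 1), h⟩
    rw [simpleRoot, if_neg (by simp)] at h1
    have h2 := (simpleCone n).add_mem (ih (by omega)) h1
    convert h2 using 1
    push_cast
    rw [add_assoc (i : ℤ) d 1]
    abel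

theorem rootOf_mem_simpleCone {n i j : ℕ} (hij : i < j) (hj : j < n) (b : Bool) :
    rootOf n i j b ∈ simpleCone n := by
  cases b
  · have := stdVec_sub_mem_simpleCone (n := n) (i := i) (j - i) (by omega)
    rw [show i + (j - i) = j by omega] at this
    simpa [rootOf, sub_eq_add_neg] using this
  -- In coordinates numbered from one, `e_{i+1} + e_{j+1} = (e_1 + e_2) + (e_{i+1} - e_1) + (e_{j+1}
  -- - e_2)`, which uses `j ≥ 1`.
  · have h0 := simpleRoot_mem_simpleCone (n := n) ⟨0, by omega⟩
    have h1 := stdVec_sub_mem_simpleCone (n := n) (i := 0) i (by omega)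
    have h2 := stdVec_sub_mem_simpleCone (n := n) (i := 1) (j - 1) (by omega)
    rw [show 1 + (j - 1) = j by omega] at h2
    rw [zero_add] at h1
    rw [simpleRoot, if_pos rfl] at h0
    have := (simpleCone n).add_mem (AddSubmonoid.add_mem _ h0 h1) h2
    convert this using 1
    simp only [rootOf, cond_true]
    norm_num
    abel

theorem rootOf_mem_roots {n i j : ℕ} (hij : i < j) (hj : j < n) (b : Bool) :
    rootOf n i j b ∈ roots n := by
  refine ⟨i + 1, j + 1, by omega, by omega, by omega, ?_⟩
  cases b
  · right; left; simp [rootOf, sub_eq_add_neg]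
  · right; right; left; simp [rootOf, add_comm]

theorem mem_roots_iff {n : ℕ} {v : Fin n → ℤ} :
    v ∈ roots n ↔
      ∃ i j b, i < j ∧ j < n ∧ (v = rootOf n i j b ∨ v = -rootOf n i j b) := by
  constructor
  · rintro ⟨i, j, hi, hij, hj, hv⟩
    obtain ⟨i, rfl⟩ : ∃ r : ℕ, i = (r : ℤ) + 1 := ⟨(i - 1).toNat, by omega⟩
    obtain ⟨j, rfl⟩ : ∃ r : ℕ, j = (r : ℤ) + 1 := ⟨(j - 1).toNat, by omega⟩
    rcases hv with h | h | h | h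
    · exact ⟨i, j, false, by omega, by omega, .inr (by rw [h]; simp [rootOf]; abel)⟩
    · exact ⟨i, j, false, by omega, by omega, .inl (by rw [h]; simp [rootOf]; abel)⟩
    · exact ⟨i, j, true, by omega, by omega, .inl (by rw [h]; simp [rootOf]; abel)⟩
    · exact ⟨i, j, true, by omega, by omega, .inr (by rw [h]; simp [rootOf]; abel)⟩
  · rintro ⟨i, j, b, hij, hj, rfl | rfl⟩
    · exact rootOf_mem_roots hij hj b
    · obtain ⟨k, l, h1, h2, h3, h4⟩ := rootOf_mem_roots hij hj b
      refine ⟨k, l, h1, h2, h3, ?_⟩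
      rcases h4 with h | h | h | h <;> rw [h] <;> simp

theorem neg_mem_roots {n : ℕ} {v : Fin n → ℤ} (hv : v ∈ roots n) : -v ∈ roots n := by
  rw [mem_roots_iff] at hv ⊢
  obtain ⟨i, j, b, hij, hj, rfl | rfl⟩ := hv
  · exact ⟨i, j, b, hij, hj, .inr rfl⟩
  · exact ⟨i, j, b, hij, hj, .inl (by simp)⟩

theorem ht_rootOf_pos {n i j : ℕ} (hij : i < j) (hj : j < n) (b : Bool) :
    0 < ht (rootOf n i j b) := by
  rw [ht_rootOf hij hj]
  cases b <;> simp <;> omega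

/-- A nonnegative combination of simple roots has nonnegative height, whereas the negative of any
`rootOf` has negative height. -/
theorem mem_posRoots_iff_exists {n : ℕ} (hn : 2 ≤ n) {v : Fin n → ℤ} :
    v ∈ posRoots n ↔ ∃ i j b, i < j ∧ j < n ∧ v = rootOf n i j b := by
  constructor
  · rintro ⟨hv, c, hc⟩
    obtain ⟨i, j, b, hij, hj, h | h⟩ := mem_roots_iff.1 hv
    · exact ⟨i, j, b, hij, hj, h⟩
    · exfalso
      have h1 := ht_rootOf_pos hij hj b
      have h2 : ht v = ∑ i, (c i : ℤ) := by
        rw [← ht_sum_simpleRoot hn, hc]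
        simp
      have h3 : (0 : ℤ) ≤ ∑ i, (c i : ℤ) := Finset.sum_nonneg fun _ _ => by positivity
      rw [h, map_neg] at h2
      omega
  · rintro ⟨i, j, b, hij, hj, rfl⟩
    exact ⟨rootOf_mem_roots hij hj b, rootOf_mem_simpleCone hij hj b⟩

theorem mem_posRoots_iff_ht {n : ℕ} (hn : 2 ≤ n) {v : Fin n → ℤ} (hv : v ∈ roots n) :
    v ∈ posRoots n ↔ 0 < ht v := by
  rw [mem_posRoots_iff_exists hn]
  constructor
  · rintro ⟨i, j, b, hij, hj, rfl⟩
    exact ht_rootOf_pos hij hj b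
  · intro h
    obtain ⟨i, j, b, hij, hj, h' | h'⟩ := mem_roots_iff.1 hv
    · exact ⟨i, j, b, hij, hj, h'⟩
    · have := ht_rootOf_pos hij hj b
      rw [h', map_neg] at h
      omega

theorem mem_negRoots_iff_ht {n : ℕ} (hn : 2 ≤ n) {v : Fin n → ℤ} (hv : v ∈ roots n) :
    v ∈ negRoots n ↔ ht v < 0 := by
  rw [negRoots, Set.mem_ofPred_eq, mem_posRoots_iff_ht hn (neg_mem_roots hv), map_neg, neg_pos]

theorem exists_odd_height_iff {n : ℕ} (hn : 2 ≤ n) {v : Fin n → ℤ} (hv : v ∈ posRoots n) :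
    (∃ h, HasHeight v h ∧ Odd h) ↔ Odd (ht v) := by
  constructor
  · rintro ⟨h, h1, h2⟩
    rwa [← h1.eq_ht hn]
  · intro h
    obtain ⟨_, c, hc⟩ := hv
    refine ⟨ht v, ⟨fun i => c i, by rw [hc]; simp, ?_⟩, h⟩
    rw [← ht_sum_simpleRoot hn, hc]
    simp

theorem stdVec_add_mem_roots {n : ℕ} {a b : ℤ} (ha : a ≠ 0) (han : |a| ≤ n) (hb : b ≠ 0)
    (hbn : |b| ≤ n) (hab : |a| ≠ |b|) : stdVec n a + stdVec n b ∈ roots n := by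
  wlog h : |a| < |b| generalizing a b
  · rw [add_comm]
    exact this hb hbn ha han hab.symm (lt_of_le_of_ne (not_lt.1 h) hab.symm)
  have h1 := Int.one_le_abs ha
  refine ⟨|a|, |b|, h1, h, hbn, ?_⟩
  rcases abs_choice a with h2 | h2 <;> rcases abs_choice b with h3 | h3 <;> rw [h2, h3]
  · simp
  · simp [stdVec_neg]
  · right; left; simp [stdVec_neg, sub_eq_add_neg, add_comm]
  · right; right; right; simp [stdVec_neg, add_comm]

/-- The height is `a + b` minus the two signs. Opposite signs cancel; if both are negative, `|a| ≠
|b|` forces `a + b ≤ -3`, so adding two does not change the sign. -/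
theorem ht_stdVec_add_neg_iff {n : ℕ} {a b : ℤ} (ha : a ≠ 0) (han : |a| ≤ n) (hb : b ≠ 0)
    (hbn : |b| ≤ n) (hab : |a| ≠ |b|) : ht (stdVec n a + stdVec n b) < 0 ↔ a + b < 0 := by
  rw [map_add, ht_stdVec ha han, ht_stdVec hb hbn]
  rcases lt_or_gt_of_ne ha with h1 | h1 <;> rcases lt_or_gt_of_ne hb with h2 | h2 <;>
    simp only [Int.sign_eq_one_of_pos, Int.sign_eq_neg_one_of_neg, h1, h2]
  all_goals
    simp only [abs_of_pos, abs_of_neg, h1, h2] at hab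
    omega

/-! ### Entries of a signed permutation, and length and odd length as counts of pairs. -/

/-- The entries `w(1), …, w(n)` of a signed permutation, numbered from `0` and continued by
zero. -/
noncomputable def entry {n : ℕ} (w : Equiv.Perm (SignedIndex n)) (k : ℕ) : ℤ :=
  if h : k < n then (w (pos ⟨k, h⟩)).1 else 0

theorem entry_of_lt {n : ℕ} (w : Equiv.Perm (SignedIndex n)) {k : ℕ} (h : k < n) :
    entry w k = (w (pos ⟨k, h⟩)).1 := dif_pos h

theorem entry_ne_zero {n : ℕ} (w : Equiv.Perm (SignedIndex n)) {k : ℕ} (h : k < n) :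
    entry w k ≠ 0 := by
  rw [entry_of_lt w h]; exact (w _).2.1

theorem abs_entry_le {n : ℕ} (w : Equiv.Perm (SignedIndex n)) {k : ℕ} (h : k < n) :
    |entry w k| ≤ n := by
  rw [entry_of_lt w h]; exact (w _).2.2

theorem abs_entry_ne {n : ℕ} {w : Equiv.Perm (SignedIndex n)} (hw : ∀ k, w (-k) = -w k)
    {i j : ℕ} (hi : i < n) (hj : j < n) (hij : i ≠ j) : |entry w i| ≠ |entry w j| := by
  rw [entry_of_lt w hi, entry_of_lt w hj]
  intro h
  rcases abs_eq_abs.1 h with h | h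
  · have := congrArg Subtype.val (w.injective (Subtype.ext h))
    simp [pos] at this
    omega
  · have h' : w (pos ⟨i, hi⟩) = w (-pos ⟨j, hj⟩) := by rw [hw]; exact Subtype.ext h
    have := congrArg Subtype.val (w.injective h')
    change ((i : ℤ) + 1) = -((j : ℤ) + 1) at this
    omega

theorem entry_ne {n : ℕ} {w : Equiv.Perm (SignedIndex n)} (hw : ∀ k, w (-k) = -w k)
    {i j : ℕ} (hi : i < n) (hj : j < n) (hij : i ≠ j) : entry w i ≠ entry w j :=
  fun h => abs_entry_ne hw hi hj hij (by rw [h])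

theorem act_add {n : ℕ} (w : Equiv.Perm (SignedIndex n)) (u v : Fin n → ℤ) :
    act w (u + v) = act w u + act w v := by
  simp [act, add_smul, Finset.sum_add_distrib]

theorem act_neg {n : ℕ} (w : Equiv.Perm (SignedIndex n)) (v : Fin n → ℤ) :
    act w (-v) = -act w v := by
  simp [act]

theorem act_stdVec {n : ℕ} (w : Equiv.Perm (SignedIndex n)) {k : ℕ} (h : k < n) :
    act w (stdVec n (k + 1)) = stdVec n (entry w k) := by
  rw [act, Finset.sum_eq_single ⟨k, h⟩]
  · rw [entry_of_lt w h, stdVec, abs_of_nonneg (by omega), if_pos rfl,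
      Int.sign_eq_one_of_pos (by omega), one_smul]
  · intro m _ hm
    have : (m : ℕ) ≠ k := fun h' => hm (Fin.ext h')
    rw [stdVec, abs_of_nonneg (by omega), if_neg (by omega), zero_smul]
  · simp

theorem act_rootOf_mem_negRoots_iff {n : ℕ} (hn : 2 ≤ n) {w : Equiv.Perm (SignedIndex n)}
    (hw : ∀ k, w (-k) = -w k) {i j : ℕ} (hij : i < j) (hj : j < n) (b : Bool) :
    act w (rootOf n i j b) ∈ negRoots n ↔
      bif b then entry w i + entry w j < 0 else entry w j < entry w i := by
  have hi : i < n := by omega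
  have h1 := entry_ne_zero w hi
  have h2 := abs_entry_le w hi
  have h3 := entry_ne_zero w hj
  have h4 := abs_entry_le w hj
  have h5 := abs_entry_ne hw hi hj hij.ne
  cases b
  · simp only [rootOf, cond_false, act_add, act_neg, act_stdVec w hi, act_stdVec w hj]
    rw [← stdVec_neg, mem_negRoots_iff_ht hn, ht_stdVec_add_neg_iff] <;>
      first
      | omega
      | (apply stdVec_add_mem_roots <;> first | omega | (rw [abs_neg]; omega))
      | (rw [abs_neg]; omega)
  · simp only [rootOf, cond_true, act_add, act_stdVec w hi, act_stdVec w hj]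
    rw [mem_negRoots_iff_ht hn, ht_stdVec_add_neg_iff] <;>
      first
      | omega
      | (apply stdVec_add_mem_roots <;> omega)

/-- The number of pairs `i < j < n` related by `R` with `f j < f i`, plus the number of those
with `f i + f j < 0`. -/
def weight (n : ℕ) (R : ℕ → ℕ → Prop) [DecidableRel R] (f : ℕ → ℤ) : ℕ :=
  ∑ i ∈ Finset.range n, ∑ j ∈ Finset.range n,
    if i < j ∧ R i j then
      (if f j < f i then 1 else 0) + (if f i + f j < 0 then 1 else 0)
    else 0

/-- One count serves both statistics: `R` is trivial for the length and "opposite parity" for the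
odd length. It may depend on the positions alone because `Q` treats the two roots `e_{j+1} ±
e_{i+1}` alike. -/
theorem ncard_posRoots_eq_weight {n : ℕ} (hn : 2 ≤ n) {w : Equiv.Perm (SignedIndex n)}
    (hw : ∀ k, w (-k) = -w k) (R : ℕ → ℕ → Prop) [DecidableRel R] (Q : (Fin n → ℤ) → Prop)
    (hQ : ∀ i j b, i < j → j < n → (Q (rootOf n i j b) ↔ R i j)) :
    {α ∈ posRoots n | Q α ∧ act w α ∈ negRoots n}.ncard = weight n R (entry w) := by
  classical
  let T : Finset (ℕ × ℕ × Bool) :=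
    (Finset.range n ×ˢ Finset.range n ×ˢ Finset.univ).filter fun t =>
      (t.1 < t.2.1 ∧ R t.1 t.2.1) ∧
        bif t.2.2 then entry w t.1 + entry w t.2.1 < 0 else entry w t.2.1 < entry w t.1
  have h1 : {α ∈ posRoots n | Q α ∧ act w α ∈ negRoots n} =
      (fun t : ℕ × ℕ × Bool => rootOf n t.1 t.2.1 t.2.2) '' (T : Set (ℕ × ℕ × Bool)) := by
    ext v
    constructor
    · rintro ⟨hv, hq, hneg⟩
      obtain ⟨i, j, b, hij, hj, rfl⟩ := (mem_posRoots_iff_exists hn).1 hv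
      refine ⟨(i, j, b), ?_, rfl⟩
      rw [act_rootOf_mem_negRoots_iff hn hw hij hj] at hneg
      simp only [T, Finset.coe_filter, Finset.mem_product, Finset.mem_range, Finset.mem_univ,
        and_true, Set.mem_ofPred_eq]
      exact ⟨⟨by omega, hj⟩, ⟨hij, (hQ i j b hij hj).1 hq⟩, hneg⟩
    · rintro ⟨⟨i, j, b⟩, ht, rfl⟩
      simp only [T, Finset.coe_filter, Finset.mem_product, Finset.mem_range, Finset.mem_univ,
        and_true, Set.mem_ofPred_eq] at ht
      obtain ⟨⟨_, hj⟩, ⟨hij, hR⟩, hneg⟩ := ht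
      exact ⟨(mem_posRoots_iff_exists hn).2 ⟨i, j, b, hij, hj, rfl⟩, (hQ i j b hij hj).2 hR,
        (act_rootOf_mem_negRoots_iff hn hw hij hj b).2 hneg⟩
  rw [h1, Set.InjOn.ncard_image, Set.ncard_coe_finset, Finset.card_filter,
    Finset.sum_product, weight]
  · refine Finset.sum_congr rfl fun i _ => ?_
    rw [Finset.sum_product]
    refine Finset.sum_congr rfl fun j _ => ?_
    rw [Fintype.sum_bool]
    by_cases h : i < j ∧ R i j
    · simp only [h, and_self, true_and, cond_true, cond_false, if_true]
      exact add_comm _ _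
    · simp only [h, false_and, if_false]
  · rintro ⟨i, j, b⟩ ht ⟨i', j', b'⟩ ht' h
    simp only [T, Finset.coe_filter, Finset.mem_product, Finset.mem_range, Finset.mem_univ,
        and_true, Set.mem_ofPred_eq] at ht ht'
    obtain ⟨rfl, rfl, rfl⟩ :=
      rootOf_injective ht.2.1.1 ht.1.2 ht'.2.1.1 ht'.1.2 h
    rfl

theorem len_eq_weight {n : ℕ} (hn : 2 ≤ n) {w : Equiv.Perm (SignedIndex n)}
    (hw : ∀ k, w (-k) = -w k) : len w = weight n (fun _ _ => True) (entry w) := by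
  rw [← ncard_posRoots_eq_weight hn hw _ (fun _ => True) (by simp), len]
  simp only [true_and]

theorem oddLen_eq_weight {n : ℕ} (hn : 2 ≤ n) {w : Equiv.Perm (SignedIndex n)}
    (hw : ∀ k, w (-k) = -w k) :
    oddLen w = weight n (fun i j => i % 2 ≠ j % 2) (entry w) := by
  rw [← ncard_posRoots_eq_weight hn hw _ (fun v => Odd (ht v)), oddLen]
  · congr 1
    ext v
    simp only [Set.mem_ofPred_eq]
    refine and_congr_right fun hv => ?_
    rw [exists_odd_height_iff hn hv]
  -- The two roots attached to `i < j` have heights `j + i` and `j - i`, which share their parity.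
  · intro i j b hij hj
    rw [ht_rootOf hij hj, Int.odd_iff]
    cases b <;> simp only [cond_true, cond_false] <;> omega

/-! ### Exchanging two entries -/

theorem sum_sum_eq_two_mul_sum_lt (s : Finset ℕ) (D : ℕ → ℕ → ℤ) (hs : ∀ i j, D i j = D j i)
    (h0 : ∀ i, D i i = 0) :
    ∑ i ∈ s, ∑ j ∈ s, D i j = 2 * ∑ i ∈ s, ∑ j ∈ s, if i < j then D i j else 0 := by
  have h : ∀ i j, D i j = (if i < j then D i j else 0) + if j < i then D j i else 0 := by
    intro i j
    rcases lt_trichotomy i j with h | rfl | h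
    · rw [if_pos h, if_neg h.not_gt, add_zero]
    · simp [h0]
    · rw [if_neg h.not_gt, if_pos h, zero_add, hs]
  have h' : ∑ i ∈ s, ∑ j ∈ s, D i j = ∑ i ∈ s, ∑ j ∈ s,
      ((if i < j then D i j else 0) + if j < i then D j i else 0) :=
    Finset.sum_congr rfl fun i _ => Finset.sum_congr rfl fun j _ => h i j
  rw [h', two_mul]
  simp only [Finset.sum_add_distrib]
  congr 1
  exact Finset.sum_comm

/-- Applied to the change of a pair statistic under exchanging positions `p` and `q`, which involves
only pairs meeting `{p, q}`. -/
theorem sum_sum_eq_of_two_rows (s : Finset ℕ) {p q : ℕ} (hp : p ∈ s) (hq : q ∈ s) (hpq : p ≠ q)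
    (E : ℕ → ℕ → ℤ) (hs : ∀ i j, E i j = E j i) (h0 : ∀ i, E i i = 0)
    (hE : ∀ i j, i ≠ p → i ≠ q → j ≠ p → j ≠ q → E i j = 0) :
    ∑ i ∈ s, ∑ j ∈ s, E i j = 2 * (E p q + ∑ k ∈ (s.erase p).erase q, (E p k + E q k)) := by
  have hq' : q ∈ s.erase p := Finset.mem_erase.2 ⟨hpq.symm, hq⟩
  have split : ∀ g : ℕ → ℤ, ∑ i ∈ s, g i = g p + (g q + ∑ k ∈ (s.erase p).erase q, g k) := by
    intro g
    rw [Finset.add_sum_erase _ g hq', Finset.add_sum_erase _ g hp]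
  have h1 : ∀ k ∈ (s.erase p).erase q, ∑ j ∈ s, E k j = E p k + E q k := by
    intro k hk
    simp only [Finset.mem_erase] at hk
    rw [split, Finset.sum_eq_zero, add_zero, hs k p, hs k q]
    intro j hj
    simp only [Finset.mem_erase] at hj
    exact hE k j hk.2.1 hk.1 hj.2.1 hj.1
  rw [split, Finset.sum_congr rfl h1, split, split, h0, h0, hs q p, Finset.sum_add_distrib]
  ring

/-- The contribution of the unordered pair `{i, j}` to the weight. -/
def pairWeight (R : ℕ → ℕ → Prop) [DecidableRel R] (f : ℕ → ℤ) (i j : ℕ) : ℤ :=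
  if i ≠ j ∧ R i j then
    (if (i < j ∧ f j < f i) ∨ (j < i ∧ f i < f j) then 1 else 0) +
      (if f i + f j < 0 then 1 else 0)
  else 0

theorem pairWeight_comm {R : ℕ → ℕ → Prop} [DecidableRel R] (hR : ∀ i j, R i j ↔ R j i)
    (f : ℕ → ℤ) (i j : ℕ) : pairWeight R f i j = pairWeight R f j i := by
  simp only [pairWeight, hR i j, ne_comm (a := i), add_comm (f i), or_comm (a := i < j ∧ _)]

theorem two_mul_weight {n : ℕ} {R : ℕ → ℕ → Prop} [DecidableRel R] (hR : ∀ i j, R i j ↔ R j i)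
    (f : ℕ → ℤ) :
    (2 * weight n R f : ℤ) = ∑ i ∈ Finset.range n, ∑ j ∈ Finset.range n, pairWeight R f i j := by
  rw [sum_sum_eq_two_mul_sum_lt _ _ (pairWeight_comm hR f) (by simp [pairWeight]), weight]
  push_cast
  congr 1
  refine Finset.sum_congr rfl fun i _ => Finset.sum_congr rfl fun j _ => ?_
  unfold pairWeight
  by_cases h : i < j
  · simp [h, h.ne, h.not_gt]
  · simp [h]

/-- The effect on the weight of exchanging the entries `f p < f q` at positions `p < q`. -/
theorem weight_comp_swap {n : ℕ} {R : ℕ → ℕ → Prop} [DecidableRel R] (hR : ∀ i j, R i j ↔ R j i)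
    {p q : ℕ} (hpq : p < q) (hq : q < n)
    (hRpq : ∀ k, k ≠ p → k ≠ q → (R p k ↔ R q k)) {f : ℕ → ℤ}
    (hf : ∀ i j, i < n → j < n → i ≠ j → f i ≠ f j) (hlt : f p < f q) :
    weight n R (f ∘ Equiv.swap p q) = weight n R f + (if R p q then 1 else 0) +
      2 * ((Finset.Ioo p q).filter fun k => R p k ∧ f p < f k ∧ f k < f q).card := by
  set τ := Equiv.swap p q with hτ
  have τp : τ p = q := Equiv.swap_apply_left _ _
  have τq : τ q = p := Equiv.swap_apply_right _ _
  have τk : ∀ k, k ≠ p → k ≠ q → τ k = k := fun k h h' => Equiv.swap_apply_of_ne_of_ne h h'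
  have hmem : ∀ k, k ∈ Finset.range n ↔ τ k ∈ Finset.range n := by
    intro k
    by_cases h : k = p
    · subst h; rw [τp]; simp only [Finset.mem_range]; omega
    · by_cases h' : k = q
      · subst h'; rw [τq]; simp only [Finset.mem_range]; omega
      · rw [τk k h h']
  -- The change is measured against the old weight reindexed by the transposition, so that the
  -- symmetric indicators of `f i + f j < 0` cancel term by term.
  have hre : ∑ i ∈ Finset.range n, ∑ j ∈ Finset.range n, pairWeight R f (τ i) (τ j) =
      ∑ i ∈ Finset.range n, ∑ j ∈ Finset.range n, pairWeight R f i j :=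
    Finset.sum_equiv τ hmem fun i _ => Finset.sum_equiv τ hmem fun j _ => rfl
  have hRτ : ∀ i j, i ≠ j → (R (τ i) (τ j) ↔ R i j) := by
    have half : ∀ i j, i ≠ j → i = p ∨ i = q → (R (τ i) (τ j) ↔ R i j) := by
      rintro i j hij (rfl | rfl)
      · by_cases h : j = q
        · subst h; rw [τp, τq]; exact hR _ _
        · rw [τp, τk j hij.symm h]; exact (hRpq j hij.symm h).symm
      · by_cases h : j = p
        · subst h; rw [τp, τq]; exact hR _ _
        · rw [τq, τk j h hij.symm]; exact hRpq j h hij.symm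
    intro i j hij
    by_cases hi : i = p ∨ i = q
    · exact half i j hij hi
    by_cases hj : j = p ∨ j = q
    · rw [hR (τ i), hR i]; exact half j i hij.symm hj
    · push Not at hi hj
      rw [τk i hi.1 hi.2, τk j hj.1 hj.2]
  set E : ℕ → ℕ → ℤ := fun i j => pairWeight R (f ∘ τ) i j - pairWeight R f (τ i) (τ j) with hE
  have hEs : ∀ i j, E i j = E j i := by
    intro i j
    simp only [hE]
    rw [pairWeight_comm hR, pairWeight_comm hR f]
  have hE0 : ∀ i, E i i = 0 := by
    intro i
    simp [hE, pairWeight]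
  have hEn : ∀ i j, i ≠ p → i ≠ q → j ≠ p → j ≠ q → E i j = 0 := by
    intro i j h1 h2 h3 h4
    simp only [hE, pairWeight, Function.comp, τk i h1 h2, τk j h3 h4, sub_self]
  have hEpq : E p q = if R p q then 1 else 0 := by
    simp only [hE, pairWeight, Function.comp, τp, τq, hR q p, add_comm (f q), hpq.ne, hpq.ne',
      hpq, hpq.not_gt, hlt, hlt.not_gt, Ne, not_false_iff, true_and, false_and, or_false,
      if_true, if_false]
    split_ifs <;> simp
  -- For a third position `k` the two differences cancel, unless `k` lies between `p` and `q` in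
  -- position and `f k` lies between `f p` and `f q` in value; then both pairs become inversions.
  have hEk : ∀ k ∈ ((Finset.range n).erase p).erase q, E p k + E q k =
      if k ∈ Finset.Ioo p q ∧ R p k ∧ f p < f k ∧ f k < f q then 2 else 0 := by
    intro k hk
    simp only [Finset.mem_erase, Finset.mem_range] at hk
    obtain ⟨hkq, hkp, hkn⟩ := hk
    have h1 := hf k p hkn (by omega) hkp
    have h2 := hf k q hkn (by omega) hkq
    simp only [hE, pairWeight, Function.comp, τp, τq, τk k hkp hkq, ← hRpq k hkp hkq,
      Finset.mem_Ioo]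
    by_cases hr : R p k
    · simp only [hr, hkp.symm, hkq.symm, Ne, not_false_iff, true_and, and_true, if_true]
      rcases lt_or_gt_of_ne hkp with h3 | h3 <;> rcases lt_or_gt_of_ne hkq with h4 | h4 <;>
      rcases lt_or_gt_of_ne h1 with h5 | h5 <;> rcases lt_or_gt_of_ne h2 with h6 | h6 <;>
        omega
    · simp only [hr, and_false, false_and, if_false, sub_self, add_zero]
  have hsum := sum_sum_eq_of_two_rows (Finset.range n) (Finset.mem_range.2 (hpq.trans hq))
    (Finset.mem_range.2 hq) hpq.ne E hEs hE0 hEn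
  rw [hEpq, Finset.sum_congr rfl hEk, ← Finset.sum_filter, Finset.sum_const] at hsum
  have hcard : (((Finset.range n).erase p).erase q).filter
      (fun k => k ∈ Finset.Ioo p q ∧ R p k ∧ f p < f k ∧ f k < f q) =
      (Finset.Ioo p q).filter fun k => R p k ∧ f p < f k ∧ f k < f q := by
    ext k
    simp only [Finset.mem_filter, Finset.mem_erase, Finset.mem_range, Finset.mem_Ioo]
    constructor
    · rintro ⟨_, h, h'⟩; exact ⟨h, h'⟩
    · rintro ⟨h, h'⟩; exact ⟨⟨by omega, by omega, by omega⟩, h, h'⟩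
  rw [hcard] at hsum
  simp only [hE, Finset.sum_sub_distrib] at hsum
  rw [hre, ← two_mul_weight hR, ← two_mul_weight hR, nsmul_eq_mul] at hsum
  zify
  linarith

/-- The function obtained from `f` by exchanging and negating the first two values. -/
def negSwapFirst (f : ℕ → ℤ) (k : ℕ) : ℤ :=
  if k = 0 then -f 1 else if k = 1 then -f 0 else f k

theorem weight_add_two (m : ℕ) (f : ℕ → ℤ) :
    weight (m + 2) (fun _ _ => True) f =
      (∑ i ∈ Finset.range m, ∑ j ∈ Finset.range m, if i < j then
        (if f (j + 2) < f (i + 2) then 1 else 0) + (if f (i + 2) + f (j + 2) < 0 then 1 else 0)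
        else 0) +
      ∑ j ∈ Finset.range m,
        ((if f (j + 2) < f 1 then 1 else 0) + (if f 1 + f (j + 2) < 0 then 1 else 0) +
        ((if f (j + 2) < f 0 then 1 else 0) + (if f 0 + f (j + 2) < 0 then 1 else 0))) +
      ((if f 1 < f 0 then 1 else 0) + (if f 0 + f 1 < 0 then 1 else 0)) := by
  simp only [weight, Finset.sum_range_succ', and_true]
  simp [Finset.sum_add_distrib, add_assoc]

/-- For each later position the four indicators pairing it with the first two positions are merely
permuted, so only the root `e_1 + e_2` changes status. The form with a correction on each side
avoids subtraction in `ℕ`. -/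
theorem weight_negSwapFirst {n : ℕ} (hn : 2 ≤ n) (f : ℕ → ℤ) :
    weight n (fun _ _ => True) (negSwapFirst f) + (if f 0 + f 1 < 0 then 1 else 0) =
      weight n (fun _ _ => True) f + (if 0 < f 0 + f 1 then 1 else 0) := by
  obtain ⟨m, rfl⟩ := Nat.exists_eq_add_of_le' hn
  have h0 : negSwapFirst f 0 = -f 1 := rfl
  have h1 : negSwapFirst f 1 = -f 0 := rfl
  have h2 : ∀ k, negSwapFirst f (k + 2) = f (k + 2) := fun k => by simp [negSwapFirst]
  rw [weight_add_two, weight_add_two]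
  simp only [h0, h1, h2]
  have e1 : ∀ a b : ℤ, (a < -b) = (b + a < 0) := fun a b => propext (by omega)
  have e2 : ∀ a b : ℤ, (-b + a < 0) = (a < b) := fun a b => propext (by omega)
  have e3 : (-f 0 < -f 1) = (f 1 < f 0) := propext (by omega)
  have e4 : (-f 1 + -f 0 < 0) = (0 < f 0 + f 1) := propext (by omega)
  simp only [e3, e4]
  simp only [e1, e2]
  have e5 : ∀ j ∈ Finset.range m,
      ((if f 0 + f (j + 2) < 0 then 1 else 0) + (if f (j + 2) < f 0 then 1 else 0) +
        ((if f 1 + f (j + 2) < 0 then 1 else 0) + (if f (j + 2) < f 1 then 1 else 0))) =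
      ((if f (j + 2) < f 1 then 1 else 0) + (if f 1 + f (j + 2) < 0 then 1 else 0) +
        ((if f (j + 2) < f 0 then 1 else 0) + (if f 0 + f (j + 2) < 0 then 1 else 0))) :=
    fun _ _ => by ring
  rw [Finset.sum_congr rfl e5]
  ring

/-! ### Signed swaps -/

theorem neg_ne_self {n : ℕ} (x : SignedIndex n) : -x ≠ x := by
  intro h
  have h1 : -x.1 = x.1 := congrArg Subtype.val h
  have h2 := x.2.1
  omega

theorem signedIndex_neg_neg {n : ℕ} (x : SignedIndex n) : - -x = x := Subtype.ext (neg_neg x.1)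

theorem signedIndex_neg_inj {n : ℕ} {x y : SignedIndex n} : -x = -y ↔ x = y :=
  ⟨fun h => by rw [← signedIndex_neg_neg x, h, signedIndex_neg_neg], fun h => by rw [h]⟩

theorem signedSwap_apply {n : ℕ} {j k : SignedIndex n} (h2 : j ≠ -k) (x : SignedIndex n) :
    signedSwap j k x =
      if x = j then k else if x = k then j else if x = -j then -k else if x = -k then -j
      else x := by
  have h3 := neg_ne_self j
  have h4 := neg_ne_self k
  have h5 : -j ≠ k := fun h => h2 (by rw [← h, signedIndex_neg_neg])
  have h6 : k ≠ -j := fun h => h5 h.symm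
  have h7 : -k ≠ j := fun h => h2 h.symm
  rw [signedSwap, Equiv.Perm.mul_apply]
  by_cases a1 : x = j
  · subst a1
    rw [Equiv.swap_apply_of_ne_of_ne (Ne.symm h3) h2, Equiv.swap_apply_left, if_pos rfl]
  by_cases a2 : x = k
  · subst a2
    rw [Equiv.swap_apply_of_ne_of_ne h6 (Ne.symm h4), Equiv.swap_apply_right, if_neg a1,
      if_pos rfl]
  by_cases a3 : x = -j
  · subst a3
    rw [Equiv.swap_apply_left, Equiv.swap_apply_of_ne_of_ne h7 h4, if_neg a1, if_neg a2,
      if_pos rfl]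
  by_cases a4 : x = -k
  · subst a4
    rw [Equiv.swap_apply_right, Equiv.swap_apply_of_ne_of_ne h3 h5, if_neg a1, if_neg a2,
      if_neg a3, if_pos rfl]
  rw [Equiv.swap_apply_of_ne_of_ne a3 a4, Equiv.swap_apply_of_ne_of_ne a1 a2, if_neg a1,
    if_neg a2, if_neg a3, if_neg a4]

theorem signedSwap_neg {n : ℕ} {j k : SignedIndex n} (h1 : j ≠ k) (h2 : j ≠ -k)
    (x : SignedIndex n) : signedSwap j k (-x) = -signedSwap j k x := by
  have e : ∀ y z : SignedIndex n, (-y = z) = (y = -z) := fun y z =>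
    propext ⟨fun h => by rw [← h, signedIndex_neg_neg], fun h => by rw [h, signedIndex_neg_neg]⟩
  have h3 := neg_ne_self j
  have h4 := neg_ne_self k
  have h5 : j ≠ -j := h3.symm
  have h6 : k ≠ -k := h4.symm
  have h7 : k ≠ -j := fun h => h2 (by rw [h, signedIndex_neg_neg])
  rw [signedSwap_apply h2, signedSwap_apply h2]
  simp only [e, signedIndex_neg_neg]
  by_cases a1 : x = j
  · subst a1; simp [h2, h5]
  by_cases a2 : x = k
  · subst a2; simp [h1.symm, h6, h7]
  by_cases a3 : x = -j
  · simp [a3, signedIndex_neg_neg, h3, Ne.symm h7]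
  by_cases a4 : x = -k
  · simp [a4, signedIndex_neg_neg, h4, Ne.symm h2, signedIndex_neg_inj, Ne.symm h1]
  · simp [a1, a2, a3, a4]

theorem pos_inj {n : ℕ} {i j : Fin n} : pos i = pos j ↔ i = j := by
  constructor
  · intro h
    have := congrArg Subtype.val h
    simp only [pos] at this
    exact Fin.ext (by omega)
  · rintro rfl; rfl

theorem pos_ne_neg_pos {n : ℕ} (i j : Fin n) : pos i ≠ -pos j := by
  intro h
  have : ((i : ℤ) + 1) = -((j : ℤ) + 1) := congrArg Subtype.val h
  omega

/-- The signed permutation exchanging the entries at positions `p` and `q`, numbered from `0`. -/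
def posSwap (n : ℕ) {p q : ℕ} (hp : p < n) (hq : q < n) : Equiv.Perm (SignedIndex n) :=
  signedSwap (pos ⟨p, hp⟩) (pos ⟨q, hq⟩)

theorem posSwap_apply_pos {n p q : ℕ} (hp : p < n) (hq : q < n) (i : Fin n) :
    posSwap n hp hq (pos i) = pos (Equiv.swap (⟨p, hp⟩ : Fin n) ⟨q, hq⟩ i) := by
  rw [posSwap, signedSwap_apply (pos_ne_neg_pos _ _), Equiv.swap_apply_def]
  simp only [pos_inj, pos_ne_neg_pos, if_false]
  split_ifs <;> rfl

theorem posSwap_neg {n p q : ℕ} (hp : p < n) (hq : q < n) (hpq : p ≠ q) (x : SignedIndex n) :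
    posSwap n hp hq (-x) = -posSwap n hp hq x :=
  signedSwap_neg (by rw [Ne, pos_inj, Fin.mk.injEq]; exact hpq) (pos_ne_neg_pos _ _) x

/-- The two transpositions move positive and negative indices respectively, so they are disjoint and
commute. -/
theorem posSwap_mul_self {n p q : ℕ} (hp : p < n) (hq : q < n) :
    posSwap n hp hq * posSwap n hp hq = 1 := by
  have h : Commute (Equiv.swap (pos (⟨p, hp⟩ : Fin n)) (pos ⟨q, hq⟩))
      (Equiv.swap (-pos (⟨p, hp⟩ : Fin n)) (-pos ⟨q, hq⟩)) := by
    apply Equiv.Perm.Disjoint.commute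
    intro x
    by_cases h1 : x = pos ⟨p, hp⟩
    · right; subst h1
      exact Equiv.swap_apply_of_ne_of_ne (pos_ne_neg_pos _ _) (pos_ne_neg_pos _ _)
    by_cases h2 : x = pos ⟨q, hq⟩
    · right; subst h2
      exact Equiv.swap_apply_of_ne_of_ne (pos_ne_neg_pos _ _) (pos_ne_neg_pos _ _)
    · left; exact Equiv.swap_apply_of_ne_of_ne h1 h2
  rw [posSwap, signedSwap, ← sq, h.mul_pow]
  simp [sq]

theorem entry_mul_posSwap {n p q : ℕ} (hp : p < n) (hq : q < n)
    (w : Equiv.Perm (SignedIndex n)) :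
    entry (w * posSwap n hp hq) = entry w ∘ Equiv.swap p q := by
  ext k
  simp only [Function.comp]
  by_cases hk : k < n
  · rw [entry_of_lt _ hk, Equiv.Perm.mul_apply, posSwap_apply_pos]
    simp only [Equiv.swap_apply_def, Fin.mk.injEq]
    split_ifs
    · rw [entry_of_lt _ hq]
    · rw [entry_of_lt _ hp]
    · rw [entry_of_lt _ hk]
  · rw [Equiv.swap_apply_of_ne_of_ne (by omega) (by omega), entry, entry, dif_neg hk, dif_neg hk]

theorem IsEvenSigned.mul_posSwap {n p q : ℕ} (hp : p < n) (hq : q < n) (hpq : p ≠ q)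
    {w : Equiv.Perm (SignedIndex n)} (hw : IsEvenSigned w) :
    IsEvenSigned (w * posSwap n hp hq) := by
  refine ⟨fun k => ?_, ?_⟩
  · rw [Equiv.Perm.mul_apply, Equiv.Perm.mul_apply, posSwap_neg hp hq hpq, hw.1]
  · rw [Finset.card_equiv (t := Finset.univ.filter fun i : Fin n => (w (pos i)).1 < 0)
      (Equiv.swap (⟨p, hp⟩ : Fin n) ⟨q, hq⟩)]
    · exact hw.2
    · intro i
      simp only [Finset.mem_filter, Finset.mem_univ, true_and, Equiv.Perm.mul_apply,
        posSwap_apply_pos]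

/-! ### Membership in parabolic quotients -/

/-- The condition on the entries of a signed permutation for having no descent at `i`. -/
def IsAscent (f : ℕ → ℤ) (i : ℕ) : Prop :=
  if i = 0 then 0 < f 0 + f 1 else f (i - 1) < f i

theorem isAscent_of_ne_zero {f : ℕ → ℤ} {i : ℕ} (hi : i ≠ 0) :
    IsAscent f i ↔ f (i - 1) < f i := by
  rw [IsAscent, if_neg hi]

theorem entry_mul_gen_zero {n : ℕ} (hn : 2 ≤ n) {w : Equiv.Perm (SignedIndex n)}
    (hw : ∀ k, w (-k) = -w k) :
    entry (w * gen ⟨0, by omega⟩) = negSwapFirst (entry w) := by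
  have e : ∀ y z : SignedIndex n, (-y = z) = (y = -z) := fun y z =>
    propext ⟨fun h => by rw [← h, signedIndex_neg_neg], fun h => by rw [h, signedIndex_neg_neg]⟩
  ext k
  by_cases hk : k < n
  · rw [entry_of_lt _ hk, Equiv.Perm.mul_apply, gen, if_pos rfl, dif_pos hn,
      signedSwap_apply (by rw [signedIndex_neg_neg, Ne, pos_inj]; simp)]
    simp only [pos_inj, pos_ne_neg_pos, signedIndex_neg_neg, Fin.mk.injEq, if_false]
    rw [negSwapFirst]
    split_ifs
    · rw [hw, entry_of_lt _ (by omega)]; rfl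
    · rw [hw, entry_of_lt _ (by omega)]; rfl
    · rw [entry_of_lt _ hk]
  · rw [negSwapFirst, if_neg (by omega), if_neg (by omega), entry, entry, dif_neg hk,
      dif_neg hk]

theorem signedSwap_comp_neg {n : ℕ} {w : Equiv.Perm (SignedIndex n)} (hw : ∀ k, w (-k) = -w k)
    {j k : SignedIndex n} (h1 : j ≠ k) (h2 : j ≠ -k) (x : SignedIndex n) :
    (w * signedSwap j k) (-x) = -(w * signedSwap j k) x := by
  rw [Equiv.Perm.mul_apply, Equiv.Perm.mul_apply, signedSwap_neg h1 h2, hw]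

theorem weight_mul_posSwap {n p q : ℕ} (hpq : p < q) (hq : q < n)
    {w : Equiv.Perm (SignedIndex n)} (hw : ∀ k, w (-k) = -w k) (h : entry w p < entry w q)
    {R : ℕ → ℕ → Prop} [DecidableRel R] (hR : ∀ i j, R i j ↔ R j i)
    (hRpq : ∀ k, k ≠ p → k ≠ q → (R p k ↔ R q k)) :
    weight n R (entry (w * posSwap n (hpq.trans hq) hq)) =
      weight n R (entry w) + (if R p q then 1 else 0) +
      2 * ((Finset.Ioo p q).filter fun k =>
        R p k ∧ entry w p < entry w k ∧ entry w k < entry w q).card := by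
  rw [entry_mul_posSwap]
  exact weight_comp_swap hR hpq hq hRpq (fun i j hi hj hij => entry_ne hw hi hj hij) h

theorem len_lt_len_mul_gen_iff {n : ℕ} (hn : 2 ≤ n) {w : Equiv.Perm (SignedIndex n)}
    (hw : ∀ k, w (-k) = -w k) (i : Fin n) :
    len w < len (w * gen i) ↔ IsAscent (entry w) i := by
  obtain ⟨i, hi⟩ := i
  rw [IsAscent]
  by_cases h0 : i = 0
  · subst h0
    have hw' : ∀ k, (w * gen ⟨0, hi⟩) (-k) = -(w * gen ⟨0, hi⟩) k := by
      rw [gen, if_pos rfl, dif_pos hn]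
      exact signedSwap_comp_neg hw (pos_ne_neg_pos _ _)
        (by rw [signedIndex_neg_neg, Ne, pos_inj]; simp)
    rw [if_pos rfl, len_eq_weight hn hw, len_eq_weight hn hw', entry_mul_gen_zero hn hw]
    have := weight_negSwapFirst hn (entry w)
    have hne := abs_entry_ne hw (i := 0) (j := 1) (by omega) (by omega) (by omega)
    split_ifs at this <;> omega
  · have hg : gen (⟨i, hi⟩ : Fin n) = posSwap n (p := i - 1) (q := i) (by omega) hi := by
      rw [gen, if_neg h0, posSwap]
    have hlt : ∀ v : Equiv.Perm (SignedIndex n), (∀ k, v (-k) = -v k) →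
        entry v (i - 1) < entry v i → len v < len (v * gen ⟨i, hi⟩) := by
      intro v hv h
      have hv' : ∀ k, (v * gen ⟨i, hi⟩) (-k) = -(v * gen ⟨i, hi⟩) k := by
        rw [hg]
        exact signedSwap_comp_neg hv (by rw [Ne, pos_inj, Fin.mk.injEq]; omega)
          (pos_ne_neg_pos _ _)
      rw [len_eq_weight hn hv, len_eq_weight hn hv', hg,
        weight_mul_posSwap (p := i - 1) (by omega) hi hv h (by simp) (by simp)]
      simp only [if_true]
      omega
    rw [if_neg h0]
    change _ ↔ entry w (i - 1) < entry w i
    refine ⟨fun h => ?_, hlt w hw⟩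
    -- If the entries descend, then those of `w * gen i` ascend there, and applying the generator
    -- again shows that `w` is longer than `w * gen i`.
    by_contra hcon
    have hne := entry_ne hw (i := i - 1) (j := i) (by omega) hi (by omega)
    have hlt' := hlt (w * gen ⟨i, hi⟩) (by
      rw [hg]
      exact signedSwap_comp_neg hw (by rw [Ne, pos_inj, Fin.mk.injEq]; omega)
          (pos_ne_neg_pos _ _)) (by
      rw [hg, entry_mul_posSwap]
      simp only [Function.comp, Equiv.swap_apply_left, Equiv.swap_apply_right]
      omega)
    rw [mul_assoc, hg, posSwap_mul_self, mul_one, ← hg] at hlt'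
    omega

theorem mem_quotient_iff {n : ℕ} (hn : 2 ≤ n) {I : Finset ℕ} {w : Equiv.Perm (SignedIndex n)} :
    w ∈ quotient n I ↔
      IsEvenSigned w ∧ ∀ i, i < n → i ∈ I → IsAscent (entry w) i := by
  simp only [quotient, Finset.mem_filter, Finset.mem_univ, true_and]
  refine and_congr_right fun hw => ⟨fun h i hi hI => ?_, fun h i hI => ?_⟩
  · exact (len_lt_len_mul_gen_iff hn hw.1 ⟨i, hi⟩).1 (h ⟨i, hi⟩ hI)
  · exact (len_lt_len_mul_gen_iff hn hw.1 i).2 (h i i.2 hI)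

/-! ### Shuffling a pair into a block of even length -/

theorem genFun_congr {n : ℕ} {I I' : Finset ℕ} (h : ∀ i, i < n → (i ∈ I ↔ i ∈ I')) :
    genFun n I = genFun n I' := by
  have : quotient n I = quotient n I' := by
    ext w
    simp only [quotient, Finset.mem_filter, Finset.mem_univ, true_and]
    refine and_congr_right fun _ => forall_congr' fun i => ?_
    rw [h i i.2]
  rw [genFun, genFun, this]

/-- The entries at positions `c, …, c + A - 1` and at `c + A, c + A + 1` are separately increasing
as far as `I` demands it, and exactly the first `i` (respectively `j`) entries of the former block
lie below the first (respectively second) entry of the latter. -/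
structure IsShuffle (n : ℕ) (I : Finset ℕ) (c A i j : ℕ) (f : ℕ → ℤ) : Prop where
  ascent : ∀ m, m < n → m ∈ I → IsAscent f m
  lt_left : ∀ k, k < A → (f (c + k) < f (c + A) ↔ k < i)
  lt_right : ∀ k, k < A → (f (c + k) < f (c + A + 1) ↔ k < j)

/-- `I` demands that the blocks `[c + 1, c + A]` and `[c + A + 1, c + A + 2]` of positions are
increasing, and nothing across their boundaries. -/
structure IsSplit (n : ℕ) (I : Finset ℕ) (c A : ℕ) : Prop where
  two_le : 2 ≤ c
  two_le' : 2 ≤ A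
  even : A % 2 = 0
  le : c + A + 2 ≤ n
  mem : ∀ k, c < k → k < c + A → k ∈ I
  mem_right : c + A + 1 ∈ I
  left_notMem : c ∉ I
  mid_notMem : c + A ∉ I
  right_notMem : c + A + 2 < n → c + A + 2 ∉ I

section

variable {n : ℕ} {I : Finset ℕ} {c A : ℕ}

theorem IsSplit.block_lt (hI : IsSplit n I c A) {f : ℕ → ℤ}
    (hf : ∀ m, m < n → m ∈ I → IsAscent f m) {k l : ℕ} (hkl : k < l) (hl : l < A) :
    f (c + k) < f (c + l) := by
  have hle := hI.le
  induction l with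
  | zero => omega
  | succ l ih =>
    have h := (isAscent_of_ne_zero (by omega)).1
      (hf (c + l + 1) (by omega) (hI.mem _ (by omega) (by omega)))
    rw [Nat.add_sub_cancel] at h
    rcases Nat.lt_succ_iff_lt_or_eq.1 hkl with h' | rfl
    · exact (ih h' (by omega)).trans h
    · exact h

theorem IsSplit.pair_lt (hI : IsSplit n I c A) {f : ℕ → ℤ}
    (hf : ∀ m, m < n → m ∈ I → IsAscent f m) : f (c + A) < f (c + A + 1) := by
  have hle := hI.le
  exact (isAscent_of_ne_zero (by omega)).1 (hf (c + A + 1) (by omega) hI.mem_right)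

theorem IsSplit.block_lt_iff (hI : IsSplit n I c A) {f : ℕ → ℤ}
    (hf : ∀ m, m < n → m ∈ I → IsAscent f m) {k l : ℕ} (hk : k < A) (hl : l < A) :
    f (c + k) < f (c + l) ↔ k < l := by
  rcases lt_trichotomy k l with h | rfl | h
  · exact iff_of_true (hI.block_lt hf h hl) h
  · simp
  · exact iff_of_false (hI.block_lt hf h hk).not_gt h.not_gt

/-- Exchanging the first entry of the pair with the preceding entry in value. -/
theorem IsShuffle.swap (hI : IsSplit n I c A) {i j : ℕ} (hij : i < j) (hj : j ≤ A) {f g : ℕ → ℤ}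
    (hf : ∀ k l, k < n → l < n → k ≠ l → f k ≠ f l) (h1 : g (c + i) = f (c + A))
    (h2 : g (c + A) = f (c + i)) (h3 : ∀ k, k ≠ c + i → k ≠ c + A → g k = f k)
    {a b : ℕ} (hab : a = i ∧ b = i + 1 ∨ a = i + 1 ∧ b = i) (h : IsShuffle n I c A a j f) :
    IsShuffle n I c A b j g := by
  have hle := hI.le
  have h2c := hI.two_le
  have hpair := hI.pair_lt h.ascent
  have hij' := (h.lt_right i (by omega)).2 hij
  refine ⟨fun m hm hmI => ?_, fun k hk => ?_, fun k hk => ?_⟩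
  · have hasc := h.ascent m hm hmI
    -- The condition at `0` involves positions `0` and `1` only; both lie before the block because
    -- `2 ≤ c`.
    by_cases hm0 : m = 0
    · subst hm0
      rwa [IsAscent, if_pos rfl, h3 _ (by omega) (by omega), h3 _ (by omega) (by omega)]
    obtain ⟨m, rfl⟩ := Nat.exists_eq_succ_of_ne_zero hm0
    rw [isAscent_of_ne_zero hm0, Nat.succ_eq_add_one, Nat.add_sub_cancel] at hasc ⊢
    -- No condition crosses the left end of the block or the boundary before the pair, so the moved
    -- values need no comparison there.
    have hmA : m + 1 ≠ c + A := fun h => hI.mid_notMem (h ▸ hmI)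
    have hmc : m + 1 ≠ c := fun h => hI.left_notMem (h ▸ hmI)
    by_cases e1 : m + 1 = c + i
    · rw [e1, h1, h3 m (by omega) (by omega)]
      have := (h.lt_left (i - 1) (by omega)).2 (by omega)
      rwa [show c + (i - 1) = m by omega] at this
    by_cases e2 : m = c + i
    · rw [e2, h1, h3 _ (by omega) (by omega)]
      have := (h.lt_left (i + 1) (by omega)).not.2 (by omega)
      have hne := hf (c + (i + 1)) (c + A) (by omega) (by omega) (by omega)
      rw [add_assoc]
      omega
    by_cases e3 : m = c + A
    · rw [e3, h2, h3 _ (by omega) (by omega)]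
      exact hij'
    · rw [h3 m e2 e3, h3 _ e1 hmA]
      exact hasc
  · rw [h2]
    by_cases hk' : k = i
    · rw [hk', h1]
      have := h.lt_left i (by omega)
      have hne := hf (c + i) (c + A) (by omega) (by omega) (by omega)
      omega
    · rw [h3 _ (by omega) (by omega), hI.block_lt_iff h.ascent hk (by omega)]
      omega
  · rw [h3 (c + A + 1) (by omega) (by omega)]
    by_cases hk' : k = i
    · rw [hk', h1]
      exact iff_of_true hpair hij
    · rw [h3 _ (by omega) (by omega)]
      exact h.lt_right k hk

/-- Exchanging the pair with the two preceding or following entries in value. -/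
theorem IsShuffle.swap_pair (hI : IsSplit n I c A) {j : ℕ} (hj : j + 2 ≤ A) {f g : ℕ → ℤ}
    (hf : ∀ k l, k < n → l < n → k ≠ l → f k ≠ f l) (h1 : g (c + j) = f (c + A))
    (h2 : g (c + A) = f (c + j)) (h3 : g (c + j + 1) = f (c + A + 1))
    (h4 : g (c + A + 1) = f (c + j + 1))
    (h5 : ∀ k, k ≠ c + j → k ≠ c + A → k ≠ c + j + 1 → k ≠ c + A + 1 → g k = f k)
    {a b : ℕ} (hab : a = j ∧ b = j + 2 ∨ a = j + 2 ∧ b = j) (h : IsShuffle n I c A a a f) :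
    IsShuffle n I c A b b g := by
  have hle := hI.le
  have h2c := hI.two_le
  have hpair := hI.pair_lt h.ascent
  have hjj := hI.block_lt h.ascent (k := j) (l := j + 1) (by omega) (by omega)
  rw [← add_assoc] at hjj
  refine ⟨fun m hm hmI => ?_, fun k hk => ?_, fun k hk => ?_⟩
  · have hasc := h.ascent m hm hmI
    by_cases hm0 : m = 0
    · subst hm0
      rwa [IsAscent, if_pos rfl, h5 _ (by omega) (by omega) (by omega) (by omega),
        h5 _ (by omega) (by omega) (by omega) (by omega)]
    obtain ⟨m, rfl⟩ := Nat.exists_eq_succ_of_ne_zero hm0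
    rw [isAscent_of_ne_zero hm0, Nat.succ_eq_add_one, Nat.add_sub_cancel] at hasc ⊢
    have hmA : m + 1 ≠ c + A := fun h => hI.mid_notMem (h ▸ hmI)
    have hmc : m + 1 ≠ c := fun h => hI.left_notMem (h ▸ hmI)
    -- Here the second entry of the pair moves too, so the boundary after the pair must also be free
    -- of conditions.
    have hmr : m + 1 ≠ c + A + 2 := fun h => hI.right_notMem (by omega) (h ▸ hmI)
    by_cases e1 : m + 1 = c + j
    · rw [e1, h1, h5 m (by omega) (by omega) (by omega) (by omega)]
      have := (h.lt_left (j - 1) (by omega)).2 (by omega)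
      rwa [show c + (j - 1) = m by omega] at this
    by_cases e2 : m = c + j
    · rw [e2, h1, h3]
      exact hpair
    by_cases e3 : m = c + j + 1
    · rw [e3, h3, h5 _ (by omega) (by omega) (by omega) (by omega)]
      have := (h.lt_right (j + 2) (by omega)).not.2 (by omega)
      have hne := hf (c + (j + 2)) (c + A + 1) (by omega) (by omega) (by omega)
      rw [show c + j + 1 + 1 = c + (j + 2) by omega]
      omega
    by_cases e4 : m = c + A
    · rw [e4, h2, h4]
      exact hjj
    · rw [h5 m (by omega) (by omega) (by omega) (by omega),
        h5 _ (by omega) (by omega) (by omega) (by omega)]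
      exact hasc
  · rw [h2]
    by_cases hk1 : k = j
    · rw [hk1, h1]
      have := h.lt_left j (by omega)
      have hne := hf (c + j) (c + A) (by omega) (by omega) (by omega)
      omega
    by_cases hk2 : k = j + 1
    · rw [hk2, ← add_assoc, h3]
      have := h.lt_left j (by omega)
      have := h.lt_right j (by omega)
      have hne := hf (c + j) (c + A + 1) (by omega) (by omega) (by omega)
      omega
    · rw [h5 _ (by omega) (by omega) (by omega) (by omega),
        hI.block_lt_iff h.ascent hk (by omega)]
      omega
  · rw [h4]
    have hR := h.lt_right (j + 1) (by omega)
    have hL := h.lt_left (j + 1) (by omega)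
    rw [← add_assoc] at hR hL
    have hne := hf (c + j + 1) (c + A + 1) (by omega) (by omega) (by omega)
    have hne' := hf (c + j + 1) (c + A) (by omega) (by omega) (by omega)
    by_cases hk1 : k = j
    · rw [hk1, h1]
      omega
    by_cases hk2 : k = j + 1
    · rw [hk2, ← add_assoc, h3]
      omega
    · rw [h5 _ (by omega) (by omega) (by omega) (by omega),
        add_assoc c j 1, hI.block_lt_iff h.ascent hk (by omega)]
      omega

/-! ### Signed sums over shuffles of a fixed type. -/

open Classical in
/-- The even signed permutations whose entries form a shuffle of the given type. -/
noncomputable def shuffles (n : ℕ) (I : Finset ℕ) (c A i j : ℕ) :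
    Finset (Equiv.Perm (SignedIndex n)) :=
  Finset.univ.filter fun w => IsEvenSigned w ∧ IsShuffle n I c A i j (entry w)

theorem mem_shuffles {i j : ℕ} {w : Equiv.Perm (SignedIndex n)} :
    w ∈ shuffles n I c A i j ↔ IsEvenSigned w ∧ IsShuffle n I c A i j (entry w) := by
  simp [shuffles]

/-- The signed generating function of a set of shuffles. -/
noncomputable def shuffleSum (n : ℕ) (I : Finset ℕ) (c A i j : ℕ) : ℤ[X] :=
  ∑ w ∈ shuffles n I c A i j, (-1) ^ len w * X ^ oddLen w

theorem IsEvenSigned.entry_ne {w : Equiv.Perm (SignedIndex n)} (hw : IsEvenSigned w) (k l : ℕ)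
    (hk : k < n) (hl : l < n) (hkl : k ≠ l) : entry w k ≠ entry w l :=
  TypeD.entry_ne hw.1 hk hl hkl

theorem IsEvenSigned.len_mul_posSwap {w : Equiv.Perm (SignedIndex n)} (hw : IsEvenSigned w)
    {p q : ℕ} (hpq : p < q) (hq : q < n) (h : entry w p < entry w q) :
    len (w * posSwap n (hpq.trans hq) hq) = len w + 1 +
      2 * ((Finset.Ioo p q).filter fun k => entry w p < entry w k ∧ entry w k < entry w q).card := by
  have hn : 2 ≤ n := by omega
  rw [len_eq_weight hn (hw.mul_posSwap _ hq hpq.ne).1, len_eq_weight hn hw.1,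
    weight_mul_posSwap hpq hq hw.1 h (by simp) (by simp)]
  simp

theorem IsEvenSigned.oddLen_mul_posSwap {w : Equiv.Perm (SignedIndex n)} (hw : IsEvenSigned w)
    {p q : ℕ} (hpq : p < q) (hq : q < n) (h : entry w p < entry w q) (hmod : p % 2 = q % 2) :
    oddLen (w * posSwap n (hpq.trans hq) hq) = oddLen w +
      2 * ((Finset.Ioo p q).filter fun k =>
        p % 2 ≠ k % 2 ∧ entry w p < entry w k ∧ entry w k < entry w q).card := by
  have hn : 2 ≤ n := by omega
  rw [oddLen_eq_weight hn (hw.mul_posSwap _ hq hpq.ne).1, oddLen_eq_weight hn hw.1,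
    weight_mul_posSwap hpq hq hw.1 h (fun i j => ne_comm) (fun k _ _ => by rw [hmod]),
    if_neg (not_not.2 hmod), add_zero]

/-- Exchanging positions `c + i` and `c + A` is a bijection between the two types. No entry between
these positions has an intermediate value, so the length changes by exactly one; the positions have
equal parity, as `i` and `A` are even, so the odd length is unchanged. -/
theorem shuffleSum_eq_neg (hI : IsSplit n I c A) {i j : ℕ} (hi : i % 2 = 0) (hij : i < j)
    (hj : j ≤ A) : shuffleSum n I c A i j = -shuffleSum n I c A (i + 1) j := by
  have hle := hI.le
  have hev := hI.even
  have hp : c + i < n := by omega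
  have hq : c + A < n := by omega
  rw [shuffleSum, shuffleSum, ← Finset.sum_neg_distrib]
  symm
  have key : ∀ {a b : ℕ}, (a = i ∧ b = i + 1 ∨ a = i + 1 ∧ b = i) →
      ∀ w ∈ shuffles n I c A a j, w * posSwap n hp hq ∈ shuffles n I c A b j := by
    intro a b hab w hw
    rw [mem_shuffles] at hw ⊢
    refine ⟨hw.1.mul_posSwap hp hq (by omega), ?_⟩
    rw [entry_mul_posSwap]
    refine hw.2.swap hI hij hj hw.1.entry_ne ?_ ?_ ?_ hab
    · simp
    · simp
    · intro k h1 h2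
      simp [Equiv.swap_apply_of_ne_of_ne h1 h2]
  refine Finset.sum_bij' (fun w _ => w * posSwap n hp hq) (fun w _ => w * posSwap n hp hq)
    (key (.inr ⟨rfl, rfl⟩)) (key (.inl ⟨rfl, rfl⟩)) ?_ ?_ ?_
  · intro w _; rw [mul_assoc, posSwap_mul_self, mul_one]
  · intro w _; rw [mul_assoc, posSwap_mul_self, mul_one]
  · intro w hw
    rw [mem_shuffles] at hw
    have hlt := (hw.2.lt_left i (by omega)).2 (by omega)
    have hnone : ∀ k ∈ Finset.Ioo (c + i) (c + A),
        ¬(entry w (c + i) < entry w k ∧ entry w k < entry w (c + A)) := by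
      intro k hk h
      rw [Finset.mem_Ioo] at hk
      have := hw.2.lt_left (k - c) (by omega)
      rw [show c + (k - c) = k by omega] at this
      have := this.1 h.2
      omega
    rw [hw.1.len_mul_posSwap (by omega) hq hlt, hw.1.oddLen_mul_posSwap (by omega) hq hlt
      (by omega), Finset.filter_false_of_mem hnone,
      Finset.filter_false_of_mem fun k hk h => hnone k hk h.2]
    simp [pow_succ]

/-- Going from type `(j + 2, j + 2)` to `(j, j)`, the first exchange has exactly one intermediate
entry, at position `c + j + 1` of opposite parity, and the second has none. The length grows by `3 +
1`, the odd length by `2 + 0`. -/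
theorem shuffleSum_diag (hI : IsSplit n I c A) {j : ℕ} (hj : j % 2 = 0) (hjA : j + 2 ≤ A) :
    shuffleSum n I c A j j = X ^ 2 * shuffleSum n I c A (j + 2) (j + 2) := by
  have hle := hI.le
  have hev := hI.even
  have hp : c + j < n := by omega
  have hq : c + A < n := by omega
  have hp' : c + j + 1 < n := by omega
  have hq' : c + A + 1 < n := by omega
  rw [shuffleSum, shuffleSum, Finset.mul_sum]
  symm
  refine Finset.sum_bij' (fun w _ => w * posSwap n hp hq * posSwap n hp' hq')
    (fun w _ => w * posSwap n hp' hq' * posSwap n hp hq) ?_ ?_ ?_ ?_ ?_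
  · intro w hw
    rw [mem_shuffles] at hw ⊢
    refine ⟨(hw.1.mul_posSwap hp hq (by omega)).mul_posSwap hp' hq' (by omega), ?_⟩
    rw [entry_mul_posSwap, entry_mul_posSwap]
    refine hw.2.swap_pair hI hjA hw.1.entry_ne ?_ ?_ ?_ ?_ ?_ (.inr ⟨rfl, rfl⟩)
    all_goals
      intros
      simp only [Function.comp, Equiv.swap_apply_def]
      split_ifs <;> first | rfl | omega
  · intro w hw
    rw [mem_shuffles] at hw ⊢
    refine ⟨(hw.1.mul_posSwap hp' hq' (by omega)).mul_posSwap hp hq (by omega), ?_⟩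
    rw [entry_mul_posSwap, entry_mul_posSwap]
    refine hw.2.swap_pair hI hjA hw.1.entry_ne ?_ ?_ ?_ ?_ ?_ (.inl ⟨rfl, rfl⟩)
    all_goals
      intros
      simp only [Function.comp, Equiv.swap_apply_def]
      split_ifs <;> first | rfl | omega
  · intro w _
    rw [mul_assoc (w * _), posSwap_mul_self, mul_one, mul_assoc, posSwap_mul_self, mul_one]
  · intro w _
    rw [mul_assoc (w * _), posSwap_mul_self, mul_one, mul_assoc, posSwap_mul_self, mul_one]
  · intro w hw
    rw [mem_shuffles] at hw
    set v := w * posSwap n hp hq with hv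
    have hve : IsEvenSigned v := hw.1.mul_posSwap hp hq (by omega)
    have v1 : entry v (c + j) = entry w (c + A) := by simp [hv, entry_mul_posSwap]
    have v2 : entry v (c + A) = entry w (c + j) := by simp [hv, entry_mul_posSwap]
    have v3 : ∀ k, k ≠ c + j → k ≠ c + A → entry v k = entry w k := by
      intro k h h'
      simp [hv, entry_mul_posSwap, Equiv.swap_apply_of_ne_of_ne h h']
    have hlt := (hw.2.lt_left j (by omega)).2 (by omega)
    have hlt1 := (hw.2.lt_left (j + 1) (by omega)).2 (by omega)
    have hlt2 := (hw.2.lt_right (j + 1) (by omega)).2 (by omega)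
    have hblock := hI.block_lt hw.2.ascent (k := j) (l := j + 1) (by omega) (by omega)
    rw [← add_assoc] at hlt1 hlt2 hblock
    have hone : ∀ k ∈ Finset.Ioo (c + j) (c + A),
        (entry w (c + j) < entry w k ∧ entry w k < entry w (c + A) ↔ k = c + j + 1) := by
      intro k hk
      rw [Finset.mem_Ioo] at hk
      have := hw.2.lt_left (k - c) (by omega)
      rw [show c + (k - c) = k by omega] at this
      constructor
      · intro h
        have := this.1 h.2
        omega
      · rintro rfl
        exact ⟨hblock, hlt1⟩
    have hnone : ∀ k ∈ Finset.Ioo (c + j + 1) (c + A + 1),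
        ¬(entry v (c + j + 1) < entry v k ∧ entry v k < entry v (c + A + 1)) := by
      intro k hk
      rw [Finset.mem_Ioo] at hk
      rw [v3 (c + j + 1) (by omega) (by omega), v3 (c + A + 1) (by omega) (by omega)]
      -- After the first exchange, position `c + A` holds the old entry of `c + j`, which is below
      -- the lower of the two values.
      by_cases hkA : k = c + A
      · rw [hkA, v2]
        omega
      · rw [v3 k (by omega) hkA]
        have := hw.2.lt_right (k - c) (by omega)
        rw [show c + (k - c) = k by omega] at this
        intro h
        have := this.1 h.2
        omega
    have hlt' : entry v (c + j + 1) < entry v (c + A + 1) := by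
      rw [v3 _ (by omega) (by omega), v3 _ (by omega) (by omega)]
      exact hlt2
    have f1 : (Finset.Ioo (c + j) (c + A)).filter
        (fun k => entry w (c + j) < entry w k ∧ entry w k < entry w (c + A)) = {c + j + 1} := by
      ext k
      rw [Finset.mem_filter, Finset.mem_singleton]
      constructor
      · rintro ⟨h, h'⟩; exact (hone k h).1 h'
      · intro h
        have hk : k ∈ Finset.Ioo (c + j) (c + A) := Finset.mem_Ioo.2 ⟨by omega, by omega⟩
        exact ⟨hk, (hone k hk).2 h⟩
    have f2 : (Finset.Ioo (c + j) (c + A)).filter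
        (fun k => (c + j) % 2 ≠ k % 2 ∧ entry w (c + j) < entry w k ∧
          entry w k < entry w (c + A)) = {c + j + 1} := by
      ext k
      rw [Finset.mem_filter, Finset.mem_singleton]
      constructor
      · rintro ⟨h, h'⟩; exact (hone k h).1 h'.2
      · intro h
        have hk : k ∈ Finset.Ioo (c + j) (c + A) := Finset.mem_Ioo.2 ⟨by omega, by omega⟩
        exact ⟨hk, by omega, (hone k hk).2 h⟩
    rw [hve.len_mul_posSwap (by omega) hq' hlt', hve.oddLen_mul_posSwap (by omega) hq' hlt'
      (by omega), Finset.filter_false_of_mem hnone,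
      Finset.filter_false_of_mem fun k hk h => hnone k hk h.2, hv,
      hw.1.len_mul_posSwap (by omega) hq hlt, hw.1.oddLen_mul_posSwap (by omega) hq hlt
      (by omega), f1, f2]
    simp only [Finset.card_singleton, Finset.card_empty]
    ring

/-- With every block entry below the pair, block and pair form one increasing run; conversely an
ascent at `c + A` puts the largest block entry, hence all of them, below the pair. -/
theorem shuffleSum_full (hI : IsSplit n I c A) :
    shuffleSum n I c A A A = genFun n (insert (c + A) I) := by
  have hle := hI.le
  have hA := hI.two_le'
  have : shuffles n I c A A A = quotient n (insert (c + A) I) := by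
    ext w
    rw [mem_shuffles, mem_quotient_iff (by omega)]
    refine and_congr_right fun hw => ⟨fun h m hm hmI => ?_, fun h => ?_⟩
    · rcases Finset.mem_insert.1 hmI with rfl | hmI
      · rw [isAscent_of_ne_zero (by omega)]
        have := (h.lt_left (A - 1) (by omega)).2 (by omega)
        rwa [show c + (A - 1) = c + A - 1 by omega] at this
      · exact h.ascent m hm hmI
    · have hasc : ∀ m, m < n → m ∈ I → IsAscent (entry w) m := fun m hm hmI =>
        h m hm (Finset.mem_insert_of_mem hmI)
      have hlast := (isAscent_of_ne_zero (by omega)).1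
        (h (c + A) (by omega) (Finset.mem_insert_self _ _))
      rw [show c + A - 1 = c + (A - 1) by omega] at hlast
      have hlt : ∀ k, k < A → entry w (c + k) < entry w (c + A) := by
        intro k hk
        by_cases hk' : k = A - 1
        · rwa [hk']
        · exact (hI.block_lt hasc (by omega) (by omega)).trans hlast
      exact ⟨hasc, fun k hk => iff_of_true (hlt k hk) hk,
        fun k hk => iff_of_true ((hlt k hk).trans (hI.pair_lt hasc)) hk⟩
  rw [shuffleSum, this, genFun]

theorem exists_threshold (A : ℕ) (P : ℕ → Prop) (hP : ∀ k l, k < l → l < A → P l → P k) :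
    ∃ i ≤ A, ∀ k, k < A → (P k ↔ k < i) := by
  induction A with
  | zero => exact ⟨0, le_rfl, by omega⟩
  | succ A ih =>
    by_cases h : P A
    · refine ⟨A + 1, le_rfl, fun k hk => iff_of_true ?_ hk⟩
      by_cases hk' : k = A
      · rwa [hk']
      · exact hP k A (by omega) (by omega) h
    · obtain ⟨i, hi, hi'⟩ := ih fun k l hkl hl => hP k l hkl (by omega)
      refine ⟨i, by omega, fun k hk => ?_⟩
      by_cases hk' : k = A
      · subst hk'
        exact iff_of_false h (by omega)
      · exact hi' k (by omega)

theorem threshold_unique {A : ℕ} {P : ℕ → Prop} {i i' : ℕ} (hi : i ≤ A) (hi' : i' ≤ A)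
    (h : ∀ k, k < A → (P k ↔ k < i)) (h' : ∀ k, k < A → (P k ↔ k < i')) : i = i' := by
  rcases lt_trichotomy i i' with hlt | rfl | hlt
  · have h1 := h i (by omega)
    have h2 := h' i (by omega)
    rw [h1] at h2
    omega
  · rfl
  · have h1 := h i' (by omega)
    have h2 := h' i' (by omega)
    rw [h1] at h2
    omega

/-- As the block increases, its entries below a given value form an initial segment, so each element
has exactly one type; `i ≤ j` because the pair increases. -/
theorem genFun_eq_sum_shuffleSum (hI : IsSplit n I c A) :
    genFun n I =
      ∑ j ∈ Finset.range (A + 1), ∑ i ∈ Finset.range (j + 1), shuffleSum n I c A i j := by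
  classical
  have hle := hI.le
  have hcov : quotient n I = ((Finset.range (A + 1)).sigma fun j => Finset.range (j + 1)).biUnion
      fun t => shuffles n I c A t.2 t.1 := by
    ext w
    simp only [Finset.mem_biUnion, Finset.mem_sigma, Finset.mem_range, mem_shuffles,
      mem_quotient_iff (show 2 ≤ n by omega)]
    constructor
    · rintro ⟨hw, hasc⟩
      have hpair := hI.pair_lt hasc
      obtain ⟨i, hi, hi'⟩ := exists_threshold A (fun k => entry w (c + k) < entry w (c + A))
        fun k l hkl hl h => (hI.block_lt hasc hkl hl).trans h
      obtain ⟨j, hj, hj'⟩ := exists_threshold A (fun k => entry w (c + k) < entry w (c + A + 1))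
        fun k l hkl hl h => (hI.block_lt hasc hkl hl).trans h
      refine ⟨⟨j, i⟩, ⟨Nat.lt_succ_of_le hj, ?_⟩, hw, hasc, hi', hj'⟩
      change i < j + 1
      by_contra hcon
      have h1 := (hi' j (by omega)).2 (by omega)
      have h2 := (hj' j (by omega)).1 (h1.trans hpair)
      omega
    · rintro ⟨_, _, hw, h⟩
      exact ⟨hw, h.ascent⟩
  rw [genFun, hcov, Finset.sum_biUnion, Finset.sum_sigma]
  · rfl
  · rintro ⟨j, i⟩ ht ⟨j', i'⟩ ht' hne
    rw [Finset.mem_coe, Finset.mem_sigma, Finset.mem_range, Finset.mem_range] at ht ht'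
    refine Finset.disjoint_left.2 fun w hw hw' => hne ?_
    rw [mem_shuffles] at hw hw'
    simp only at ht ht' hw hw'
    have e1 := threshold_unique (by omega) (by omega) hw.2.lt_right hw'.2.lt_right
    have e2 := threshold_unique (by omega) (by omega) hw.2.lt_left hw'.2.lt_left
    subst e1 e2
    rfl

end

theorem sum_range_eq_zero_of_pairs (g : ℕ → ℤ[X]) (t : ℕ)
    (h : ∀ i, i % 2 = 0 → i < 2 * t → g i = -g (i + 1)) : ∑ i ∈ Finset.range (2 * t), g i = 0 := by
  induction t with
  | zero => simp
  | succ t ih =>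
    rw [show 2 * (t + 1) = 2 * t + 1 + 1 by ring, Finset.sum_range_succ, Finset.sum_range_succ,
      ih fun i hi hi' => h i hi (by omega), h (2 * t) (by omega) (by omega)]
    ring

theorem sum_range_even (g : ℕ → ℤ[X]) (B : ℕ) :
    (∑ j ∈ Finset.range (2 * B + 1), if j % 2 = 0 then g j else 0) =
      ∑ t ∈ Finset.range (B + 1), g (2 * t) := by
  induction B with
  | zero => simp
  | succ B ih =>
    rw [show 2 * (B + 1) + 1 = 2 * B + 1 + 1 + 1 by ring, Finset.sum_range_succ,
      Finset.sum_range_succ, ih, Finset.sum_range_succ _ (B + 1), if_neg (by omega),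
      if_pos (by omega), add_zero]
    rfl

/-- Merging a block of length `2B` with the adjacent block of length two. -/
theorem genFun_eq_mul_genFun_insert {n : ℕ} {I : Finset ℕ} {c B : ℕ}
    (hI : IsSplit n I c (2 * B)) :
    genFun n I = (∑ t ∈ Finset.range (B + 1), X ^ (2 * t)) * genFun n (insert (c + 2 * B) I) := by
  -- The indices `i = 0, …, j` cancel in consecutive pairs: completely for odd `j`, and up to the
  -- diagonal term for even `j`.
  have h1 : ∀ j ∈ Finset.range (2 * B + 1),
      ∑ i ∈ Finset.range (j + 1), shuffleSum n I c (2 * B) i j =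
        if j % 2 = 0 then shuffleSum n I c (2 * B) j j else 0 := by
    intro j hj
    rw [Finset.mem_range] at hj
    split_ifs with h
    · obtain ⟨t, rfl⟩ : ∃ t, j = 2 * t := ⟨j / 2, by omega⟩
      rw [Finset.sum_range_succ, sum_range_eq_zero_of_pairs, zero_add]
      exact fun i hi hi' => shuffleSum_eq_neg hI hi hi' (by omega)
    · rw [show j + 1 = 2 * ((j + 1) / 2) by omega, sum_range_eq_zero_of_pairs]
      exact fun i hi hi' => shuffleSum_eq_neg hI hi (by omega) (by omega)
  -- The induction descends from the top type `(2B, 2B)`, gaining a factor `X ^ 2` at each step.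
  have h2 : ∀ t, t ≤ B → shuffleSum n I c (2 * B) (2 * (B - t)) (2 * (B - t)) =
      X ^ (2 * t) * genFun n (insert (c + 2 * B) I) := by
    intro t
    induction t with
    | zero => intro _; rw [Nat.sub_zero, shuffleSum_full hI]; simp
    | succ t ih =>
      intro ht
      rw [shuffleSum_diag hI (by omega) (by omega),
        show 2 * (B - (t + 1)) + 2 = 2 * (B - t) by omega, ih (by omega)]
      ring
  rw [genFun_eq_sum_shuffleSum hI, Finset.sum_congr rfl h1,
    sum_range_even (fun j => shuffleSum n I c (2 * B) j j), Finset.sum_mul,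
    ← Finset.sum_range_reflect]
  refine Finset.sum_congr rfl fun t ht => ?_
  rw [Finset.mem_range] at ht
  rw [show B + 1 - 1 - t = B - t by omega]
  exact h2 t (by omega)

/-! ### Merging all pairs of a block, and all blocks -/

/-- The polynomial `[m]_q!` at `q = x²`. -/
noncomputable def sqFactorial (m : ℕ) : ℤ[X] :=
  ∏ i ∈ Finset.range m, ∑ t ∈ Finset.range (i + 1), X ^ (2 * t)

/-- At `X = 1` the polynomial is a product of positive integers. This permits the final division. -/
theorem sqFactorial_ne_zero (m : ℕ) : sqFactorial m ≠ 0 := by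
  intro h
  have := congrArg (Polynomial.eval 1) h
  simp only [sqFactorial, eval_prod, eval_finsetSum, eval_pow, eval_X, one_pow, eval_zero,
    Finset.sum_const, Finset.card_range, Finset.prod_eq_zero_iff, nsmul_eq_mul, mul_one] at this
  obtain ⟨i, _, hi⟩ := this
  exact absurd hi (by exact_mod_cast Nat.succ_ne_zero i)

theorem algebraMap_sqFactorial (m : ℕ) :
    algebraMap ℤ[X] (RatFunc ℤ) (sqFactorial m) = qFactorial ((RatFunc.X : RatFunc ℤ) ^ 2) m := by
  have hX : (RatFunc.X : RatFunc ℤ) ^ 2 ≠ 1 := by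
    intro h
    rw [← RatFunc.algebraMap_X, ← map_pow, ← map_one (algebraMap ℤ[X] (RatFunc ℤ))] at h
    have h' := congrArg (Polynomial.eval 0) (RatFunc.algebraMap_injective ℤ h)
    simp at h'
  have hI : ∀ i, qInt ((RatFunc.X : RatFunc ℤ) ^ 2) i =
      ∑ t ∈ Finset.range i, (RatFunc.X : RatFunc ℤ) ^ (2 * t) := by
    intro i
    simp only [pow_mul]
    rw [geom_sum_eq hX, qInt, ← neg_sub, ← neg_sub ((RatFunc.X : RatFunc ℤ) ^ 2) 1, neg_div_neg_eq]
  rw [qFactorial, sqFactorial, map_prod, Finset.range_eq_Ico,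
    show Finset.Icc 1 m = Finset.Ico (0 + 1) (m + 1) from rfl, ← Finset.prod_Ico_add']
  refine Finset.prod_congr rfl fun i _ => ?_
  rw [hI, map_sum]
  simp [RatFunc.algebraMap_X]

/-- Merging the `m` pairs of positions in the window `[c + 1, c + 2m]` into one block. -/
theorem genFun_eq_sqFactorial_mul {n : ℕ} {I : Finset ℕ} {c m : ℕ} (hc : 2 ≤ c)
    (hn : c + 2 * m ≤ n) (hodd : ∀ k, k < m → c + 2 * k + 1 ∈ I)
    (heven : ∀ k, k ≤ m → c + 2 * k < n → c + 2 * k ∉ I) :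
    genFun n I = sqFactorial m * genFun n (I ∪ Finset.Ioo c (c + 2 * m)) := by
  have key : ∀ j, j ≤ m →
      genFun n I = sqFactorial j * genFun n (I ∪ Finset.Ioo c (c + 2 * j)) := by
    intro j
    induction j with
    | zero => intro _; simp [sqFactorial]
    | succ j ih =>
      intro hj
      rw [ih (by omega), sqFactorial, sqFactorial, Finset.prod_range_succ, mul_assoc]
      congr 1
      -- The first pair has no block before it to merge with; it contributes the factor `1`.
      by_cases h0 : j = 0
      · subst h0
        have : genFun n (I ∪ Finset.Ioo c (c + 2 * 0)) =
            genFun n (I ∪ Finset.Ioo c (c + 2 * (0 + 1))) := by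
          refine genFun_congr fun i _ => ?_
          simp only [Finset.mem_union, Finset.mem_Ioo]
          refine ⟨fun h => h.imp_right (by omega), ?_⟩
          rintro (h | h)
          · exact .inl h
          · left
            rw [show i = c + 2 * 0 + 1 by omega]
            exact hodd 0 (by omega)
        rw [this]
        simp
      -- Of the two new indices `c + 2j` and `c + 2j + 1`, the latter already lies in `I`, so
      -- inserting the former suffices.
      have hset : genFun n (I ∪ Finset.Ioo c (c + 2 * (j + 1))) =
          genFun n (insert (c + 2 * j) (I ∪ Finset.Ioo c (c + 2 * j))) := by
        refine genFun_congr fun i _ => ?_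
        simp only [Finset.mem_union, Finset.mem_insert, Finset.mem_Ioo]
        constructor
        · rintro (h | h)
          · exact .inr (.inl h)
          · by_cases e : i = c + 2 * j + 1
            · right
              left
              rw [e]
              exact hodd j (by omega)
            · omega
        · rintro (h | h | h)
          · right; omega
          · exact .inl h
          · right; omega
      rw [hset]
      refine genFun_eq_mul_genFun_insert ⟨hc, by omega, by omega, by omega, ?_, ?_, ?_, ?_, ?_⟩
      · intro k h1 h2
        exact Finset.mem_union_right _ (Finset.mem_Ioo.2 ⟨h1, h2⟩)
      · exact Finset.mem_union_left _ (hodd j (by omega))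
      · simp only [Finset.mem_union, Finset.mem_Ioo, not_or]
        exact ⟨heven 0 (by omega) (by omega), by omega⟩
      · simp only [Finset.mem_union, Finset.mem_Ioo, not_or]
        exact ⟨heven j (by omega) (by omega), by omega⟩
      · intro h
        simp only [Finset.mem_union, Finset.mem_Ioo, not_or]
        exact ⟨heven (j + 1) (by omega) (by omega), by omega⟩
  exact key m le_rfl

/-- The set in which all blocks beyond the position `r` are pairs. -/
def pairSet (n r : ℕ) : Finset ℕ := (Finset.range n).filter fun i => i < r ∨ i % 2 ≠ r % 2

/-- Blocks are merged from left to right. Earlier merges only add indices strictly inside earlier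
blocks, so the next window still consists of separate pairs. -/
theorem genFun_pairSet {n s : ℕ} {b : ℕ → ℕ} (hb : Monotone b) (hmod : ∀ r, b r % 2 = b 0 % 2)
    (h0 : 2 ≤ b 0) (hs : b s = n) :
    genFun n (pairSet n (b 0)) = (∏ r ∈ Finset.range s, sqFactorial ((b (r + 1) - b r) / 2)) *
      genFun n (pairSet n (b 0) ∪
        (Finset.range s).biUnion fun r => Finset.Ioo (b r) (b (r + 1))) := by
  have key : ∀ k, k ≤ s → genFun n (pairSet n (b 0)) =
      (∏ r ∈ Finset.range k, sqFactorial ((b (r + 1) - b r) / 2)) *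
      genFun n (pairSet n (b 0) ∪
        (Finset.range k).biUnion fun r => Finset.Ioo (b r) (b (r + 1))) := by
    intro k
    induction k with
    | zero => intro _; simp
    | succ k ih =>
      intro hk
      rw [ih (by omega), Finset.prod_range_succ, mul_assoc]
      congr 1
      have h1 := hb (Nat.zero_le k)
      have h2 := hb (Nat.le_succ k)
      have h3 : b (k + 1) ≤ n := hs ▸ hb hk
      have h4 := hmod k
      have h5 := hmod (k + 1)
      rw [Nat.succ_eq_add_one] at h2
      have e : b k + 2 * ((b (k + 1) - b k) / 2) = b (k + 1) := by omega
      rw [genFun_eq_sqFactorial_mul (c := b k) (m := (b (k + 1) - b k) / 2) (by omega) (by omega),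
        e]
      · congr 2
        ext i
        simp only [Finset.mem_union, Finset.mem_biUnion, Finset.mem_range, or_assoc,
          Nat.lt_succ_iff_lt_or_eq, or_and_right, exists_or, exists_eq_left]
      · intro l hl
        refine Finset.mem_union_left _ (Finset.mem_filter.2 ⟨Finset.mem_range.2 ?_, ?_⟩) <;> omega
      · intro l hl hln
        simp only [pairSet, Finset.mem_union, Finset.mem_biUnion, Finset.mem_filter,
          Finset.mem_range, Finset.mem_Ioo, not_or, not_and, not_exists]
        refine ⟨fun _ => by omega, fun r hr _ => ?_⟩
        have := hb (show r + 1 ≤ k by omega)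
        omega
  exact key s le_rfl

theorem exists_block {b : ℕ → ℕ} {i : ℕ} (s : ℕ) (hi : i < b s) :
    i < b 0 ∨ ∃ r < s, b r ≤ i ∧ i < b (r + 1) := by
  induction s with
  | zero => exact .inl hi
  | succ s ih =>
    by_cases h : i < b s
    · rcases ih h with h | ⟨r, hr, h⟩
      · exact .inl h
      · exact .inr ⟨r, by omega, h⟩
    · exact .inr ⟨s, by omega, by omega, hi⟩

theorem genFun_pairSet_eq_prod_mul_blockSet {n s : ℕ} {a : Fin (s + 1) → ℕ}
    (ha : IsCompressed n a) (hlast : a (Fin.last s) = n) (hlo : 2 ≤ a 0) :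
    genFun n (pairSet n (a 0)) =
      (∏ i : Fin s, sqFactorial ((a i.succ - a i.castSucc) / 2)) * genFun n (blockSet a) := by
  obtain ⟨hmono, _, hmod⟩ := ha
  -- The endpoints are continued constantly beyond `s`, which keeps the sequence monotone and its
  -- parity constant.
  let b : ℕ → ℕ := fun r => a ⟨min r s, by omega⟩
  have hb : Monotone b := fun r t hrt => hmono.monotone (by
    rw [Fin.mk_le_mk]; omega)
  have hb0 : b 0 = a 0 := congrArg a (Fin.ext (by simp))
  have hbs : b s = n := by
    rw [← hlast]; exact congrArg a (Fin.ext (by simp))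
  have hbm : ∀ r, b r % 2 = b 0 % 2 := fun r => hmod _ _
  have hbc : ∀ i : Fin s, b i = a i.castSucc := fun i =>
    congrArg a (Fin.ext (by simp))
  have hbsucc : ∀ i : Fin s, b (i + 1) = a i.succ := fun i =>
    congrArg a (Fin.ext (by simp))
  have h := genFun_pairSet hb hbm (by omega) hbs
  rw [Finset.prod_range, hb0] at h
  rw [h]
  congr 1
  · exact Finset.prod_congr rfl fun i _ => by rw [hbc, hbsucc]
  · refine genFun_congr fun i hi => ?_
    simp only [blockSet, pairSet, Finset.mem_union, Finset.mem_biUnion, Finset.mem_filter,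
      Finset.mem_range, Finset.mem_Ioo, Finset.mem_Ico, Finset.mem_univ, true_and]
    have hex : (∃ r < s, b r < i ∧ i < b (r + 1)) ↔
        ∃ r : Fin s, a r.castSucc + 1 ≤ i ∧ i < a r.succ := by
      constructor
      · rintro ⟨r, hr, h⟩
        refine ⟨⟨r, hr⟩, ?_⟩
        rw [← hbc, ← hbsucc]
        exact h
      · rintro ⟨r, h⟩
        rw [← hbc, ← hbsucc] at h
        exact ⟨r, r.2, h⟩
    rw [← hex]
    constructor
    · rintro (⟨_, h | h⟩ | h)
      · exact .inl h
      · rcases exists_block (b := b) (i := i) s (by omega) with h' | ⟨r, hr, h1, h2⟩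
        · left; omega
        · right
          refine ⟨r, hr, ?_, h2⟩
          have := hbm r
          -- An index of parity opposite to `a 0` cannot be a block endpoint, so it is interior to
          -- its block.
          have : b r ≠ i := by rintro rfl; omega
          omega
      · exact .inr h
    · rintro (h | h)
      · exact .inl ⟨hi, .inl h⟩
      · exact .inr h

end TypeD

/-! ### Comparing the two ways of merging. -/

theorem proposition4p8 (n s : ℕ) (a : Fin (s + 1) → ℕ)
    (ha : TypeD.IsCompressed n a) (hlast : a (Fin.last s) = n)
    (hlo : 2 ≤ a 0) (hhi : a 0 + 2 ≤ n) :
    algebraMap (Polynomial ℤ) (RatFunc ℤ) (TypeD.genFun n (TypeD.blockSet a)) =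
      TypeD.qMultinomial ((RatFunc.X : RatFunc ℤ) ^ 2) ((n - a 0) / 2)
          (fun i : Fin s => (a i.succ - a i.castSucc) / 2) *
        algebraMap (Polynomial ℤ) (RatFunc ℤ)
          (TypeD.genFun n (Finset.range (a 0) ∪ Finset.Ico (a 0 + 1) n)) := by
  -- The set `J` is the case of a single block beyond `a 0`, with endpoints `a 0` and `n`.
  have hJ : TypeD.IsCompressed n (s := 1) ![a 0, n] := by
    refine ⟨?_, ?_, ?_⟩
    · rw [Fin.strictMono_iff_lt_succ]
      intro i
      fin_cases i
      change a 0 < n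
      omega
    · intro i; fin_cases i
      · change a 0 ≤ n; omega
      · exact le_rfl
    · have := ha.2.2 0 (Fin.last s)
      rw [hlast] at this
      intro i j
      fin_cases i <;> fin_cases j
      · exact Nat.ModEq.rfl
      · exact this
      · exact this.symm
      · exact Nat.ModEq.rfl
  have h1 := TypeD.genFun_pairSet_eq_prod_mul_blockSet ha hlast hlo
  have h2 := TypeD.genFun_pairSet_eq_prod_mul_blockSet hJ rfl hlo
  have h3 : TypeD.blockSet (s := 1) ![a 0, n] = Finset.range (a 0) ∪ Finset.Ico (a 0 + 1) n := by
    simp [TypeD.blockSet]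
  rw [h3] at h2
  -- Both identities start from the same `pairSet n (a 0)`, which depends only on `n` and `a 0`.
  have h4 := h1.symm.trans h2
  replace h4 := congrArg (algebraMap (Polynomial ℤ) (RatFunc ℤ)) h4
  simp only [map_mul, map_prod, TypeD.algebraMap_sqFactorial, Fin.prod_univ_one] at h4
  have hne : (∏ i : Fin s, TypeD.qFactorial ((RatFunc.X : RatFunc ℤ) ^ 2)
      ((a i.succ - a i.castSucc) / 2)) ≠ 0 := by
    refine Finset.prod_ne_zero_iff.2 fun i _ => ?_
    rw [← TypeD.algebraMap_sqFactorial, Ne,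
      map_eq_zero_iff _ (RatFunc.algebraMap_injective ℤ)]
    exact TypeD.sqFactorial_ne_zero _
  rw [TypeD.qMultinomial, div_mul_eq_mul_div, eq_div_iff hne, mul_comm]
  exact h4
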